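/- Let $K$ be a commutative ring. A dg-$K$-category $\mathcal{C}$ has complexes of $K$-modules $\mathcal{C}(X,Y)$ (differential of degree $+1$) as Hom-objects, and an associative $K$-bilinear composition, with units of degree $0$, such that $d(fg)=d(f)g+(-1)^{|f|}f\,d(g)$. In $\mathcal{C}^{op}$ one has $f^{op}g^{op}=(-1)^{|f||g|}(gf)^{op}$, and in $\mathcal{C}\otimes\mathcal{D}$ one has $(a_2\otimes b_2)(a_1\otimes b_1)=(-1)^{|b_2||a_1|}a_2a_1\otimes b_2b_1$. $\mathrm{DgMod}(K)$ is the dg-category of complexes of $K$-modules. For $\mathcal{C}$ small, $\mathrm{DgMod}(\mathcal{C})$ is the dg-category of dg-functors $\mathcal{C}\to\mathrm{DgMod}(K)$; its morphisms $\eta:F\to G$ of degree $n$ are the families $\eta_X:F(X)\to G(X)$ of degree $n$ with $G(f)\eta_X=(-1)^{n|f|}\eta_YF(f)$ for all homogeneous $f:X\to Y$, with $d(\eta)_X=d(\eta_X)$. Let $\mathcal{T}$ and $\mathcal{U}$ be small dg-$K$-categories, each with at least one object, and let $M\in\mathrm{DgMod}(\mathcal{U}\otimes\mathcal{T}^{op})$.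 For homogeneous $m\in M(U,T)$, $u\in\mathcal{U}(U,U')$, $t\in\mathcal{T}(T',T)$ put $u\bullet m=M(u\otimes 1)(m)$ and $m\bullet t=(-1)^{|m||t|}M(1\otimes t^{op})(m)$. Write $M_T=M(-,T)\in\mathrm{DgMod}(\mathcal{U})$, and let $\bar t:M_T\to M_{T'}$ be given by $M(1\otimes t^{op})$. * The triangular matrix dg-category $\Lambda=\left[\begin{smallmatrix}\mathcal{T}&0\\M&\mathcal{U}\end{smallmatrix}\right]$ has as objects the pairs $(T,U)$ of an object of $\mathcal{T}$ and an object of $\mathcal{U}$, and $\Lambda\big((T,U),(T',U')\big)=\mathcal{T}(T,T')\oplus M(U',T)\oplus\mathcal{U}(U,U')$ as a complex. Its elements are written as lower triangular matrices, and composition is the matrix product $$\begin{bmatrix}t_2&0\\m_2&u_2\end{bmatrix}\begin{bmatrix}t_1&0\\m_1&u_1\end{bmatrix}=\begin{bmatrix}t_2t_1&0\\m_2\bullet t_1+u_2\bullet m_1&u_2u_1\end{bmatrix}.$$ * The dg-functor $\mathbb{G}:\mathrm{DgMod}(\mathcal{U})\to\mathrm{DgMod}(\mathcal{T})$ is $\mathbb{G}(B)(T)=\mathrm{Hom}_{\mathrm{DgMod}(\mathcal{U})}(M_T,B)$,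 where $t\in\mathcal{T}(T',T)$ acts by $\mathbb{G}(B)(t)(\eta)=(-1)^{|t||\eta|}\,\eta\,\bar t$ for $\eta\in\mathbb{G}(B)(T')$, and a morphism $\beta:B\to B'$ acts by $\eta\mapsto\beta\eta$. * The dg-comma category $\big(\mathrm{DgMod}(\mathcal{T}),\mathbb{G}(\mathrm{DgMod}(\mathcal{U}))\big)$ has as objects the triples $(A,f,B)$ with $A\in\mathrm{DgMod}(\mathcal{T})$, $B\in\mathrm{DgMod}(\mathcal{U})$ and $f:A\to\mathbb{G}(B)$ a morphism of degree $0$ with $d(f)=0$. Its morphisms $(A,f,B)\to(A',f',B')$ of degree $n$ are the pairs $(\alpha,\beta)$ of morphisms $\alpha:A\to A'$, $\beta:B\to B'$ of degree $n$ with $f'\alpha=\mathbb{G}(\beta)f$; the composition and the differential are componentwise. * For an object $(A,f,B)$ of it, $A\amalg_fB\in\mathrm{DgMod}(\Lambda)$ is given by $(A\amalg_fB)(T,U)=A(T)\oplus B(U)$, where $\left[\begin{smallmatrix}t&0\\m&u\end{smallmatrix}\right]:(T,U)\to(T',U')$ acts by $(x,y)\mapsto\big(A(t)(x),\,m\cdot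 x+B(u)(y)\big)$ with $m\cdot x=(-1)^{|m||x|}[f_T(x)]_{U'}(m)$. Then the assignment $(A,f,B)\mapsto A\amalg_fB$, $(\alpha,\beta)\mapsto(\alpha_T\amalg\beta_U)_{(T,U)}$ is a dg-functor $$\mathfrak{F}:\big(\mathrm{DgMod}(\mathcal{T}),\mathbb{G}(\mathrm{DgMod}(\mathcal{U}))\big)\longrightarrow\mathrm{DgMod}(\Lambda),$$ and $\mathfrak{F}$ is a dg-equivalence: there is a dg-functor $\mathfrak{H}$ in the opposite direction such that $\mathfrak{H}\mathfrak{F}$ and $\mathfrak{F}\mathfrak{H}$ are isomorphic to the identity dg-functors through mutually inverse closed dg-natural transformations of degree $0$. Moreover $\mathfrak{F}$ is fully faithful (bijective on the Hom-complexes in every degree) and essentially surjective (every dg $\Lambda$-module is isomorphic, through mutually inverse closed morphisms of degree $0$, to some $A\amalg_fB$). -/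

import Mathlib

open CategoryTheory TensorProduct
universe u o w o' w' o'' w''

namespace Dg

/-- A dg-category over `K`: the Hom-objects are complexes of `K`-modules (the differential has
degree `+1`), composition of homogeneous morphisms is `K`-bilinear and additive on degrees, is
associative with units of degree zero, and satisfies the graded Leibniz rule
`d(f g) = d(f) g + (-1)^{|f|} f d(g)`. `comp h f g` is the composite `f ∘ g`. -/
structure DgCategory (K : Type u) [CommRing K] where
  Obj : Type o
  Hom : Obj → Obj → CochainComplex (ModuleCat.{w} K) ℤ
  id (X : Obj) : (Hom X X).X 0
  comp {X Y Z : Obj} {i j n : ℤ} (h : i + j = n) :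
    (Hom Y Z).X i →ₗ[K] (Hom X Y).X j →ₗ[K] (Hom X Z).X n
  id_comp {X Y : Obj} {n : ℤ} (f : (Hom X Y).X n) : comp (zero_add n) (id Y) f = f
  comp_id {X Y : Obj} {n : ℤ} (f : (Hom X Y).X n) : comp (add_zero n) f (id X) = f
  assoc {W X Y Z : Obj} {i j k a b n : ℤ} (hij : i + j = a) (hjk : j + k = b)
    (h : a + k = n) (h' : i + b = n)
    (f : (Hom Y Z).X i) (g : (Hom X Y).X j) (e : (Hom W X).X k) :
    comp h (comp hij f g) e = comp h' f (comp hjk g e)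
  leibniz {X Y Z : Obj} {i j n i' j' n' : ℤ} (h : i + j = n)
    (hi : i + 1 = i') (hj : j + 1 = j') (hn : n + 1 = n')
    (f : (Hom Y Z).X i) (g : (Hom X Y).X j) :
    ((Hom X Z).d n n').hom (comp h f g) =
      comp (by omega) (((Hom Y Z).d i i').hom f) g +
        i.negOnePow • comp (by omega) f (((Hom X Y).d j j').hom g)

section
variable {K : Type u} [CommRing K]

theorem map_sign {V : Type*} {W : Type*} [AddCommGroup V] [AddCommGroup W] [Module K V]
    [Module K W] (f : V →ₗ[K] W) (s : ℤˣ) (x : V) : f (s • x) = s • f x := by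
  rw [Units.smul_def, Units.smul_def, map_zsmul]

theorem map_sign₂ {V : Type*} {W : Type*} {U : Type*} [AddCommGroup V] [AddCommGroup W]
    [AddCommGroup U] [Module K V] [Module K W] [Module K U] (f : V →ₗ[K] W →ₗ[K] U) (s : ℤˣ)
    (x : V) (y : W) : f (s • x) y = s • f x y :=
  map_sign (f.flip y) s x

theorem sign_apply {V : Type*} {W : Type*} [AddCommGroup V] [AddCommGroup W] [Module K V]
    [Module K W] (f : V →ₗ[K] W) (s : ℤˣ) (x : V) : (s • f) x = s • f x := rfl

theorem sign_congr {V : Type*} [AddCommGroup V] {a b : ℤ} (x : V) (h : Even (a - b)) :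
    a.negOnePow • x = b.negOnePow • x := by
  rw [(Int.negOnePow_eq_iff a b).2 h]

end

namespace DgCategory
variable {K : Type u} [CommRing K]

/-- The differential of the Hom-complexes, from degree `i` to degree `j` (zero unless
`j = i + 1`). -/
abbrev d (C : DgCategory.{u, o, w} K) {X Y : C.Obj} (i j : ℤ) :
    (C.Hom X Y).X i →ₗ[K] (C.Hom X Y).X j := ((C.Hom X Y).d i j).hom

/-- The opposite dg-category, with `f^op ∘ g^op = (-1)^{|f||g|} (g ∘ f)^op`. -/
abbrev op (C : DgCategory.{u, o, w} K) : DgCategory.{u, o, w} K where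
  Obj := C.Obj
  Hom X Y := C.Hom Y X
  id X := C.id X
  comp {X Y Z i j n} h := (i * j).negOnePow • (C.comp (i := j) (j := i) (by omega)).flip
  id_comp f := by simp [C.comp_id]
  comp_id f := by simp [C.id_comp]
  assoc {W X Y Z i j k a b n} hij hjk h h' f g e := by
    subst hij hjk
    simp only [sign_apply, LinearMap.flip_apply, map_sign, smul_smul,
      ← Int.negOnePow_add]
    rw [sign_congr (a := i * j + (i + j) * k) (b := j * k + i * (j + k)) _ ⟨0, by ring⟩]
    exact congrArg _ (C.assoc (by omega) (by omega) (by omega) (by omega) e g f).symm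
  leibniz {X Y Z i j n i' j' n'} h hi hj hn f g := by
    subst hi hj
    simp only [sign_apply, LinearMap.flip_apply, map_sign, smul_smul,
      ← Int.negOnePow_add]
    rw [C.leibniz (i' := j + 1) (j' := i + 1) (by omega) rfl rfl hn, smul_add, smul_smul,
      ← Int.negOnePow_add, add_comm]
    congr 1
    · apply sign_congr
      exact ⟨0, by ring⟩
    · apply sign_congr
      exact ⟨-i, by ring⟩

end DgCategory
open CochainComplex HomComplex in
/-- The Hom-complex of two complexes: degree `n` consists of the families of linear maps
`M^p → N^{p + n}`, and `d(f) = d_N f - (-1)^{|f|} f d_M`. -/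
def homComplex {K : Type u} [CommRing K] (M N : CochainComplex (ModuleCat.{w} K) ℤ) :
   CochainComplex (ModuleCat.{w} K) ℤ where
  X n := ModuleCat.of K (Cochain M N n)
  d i j := ModuleCat.ofHom (δ_hom K M N i j)
  shape i j h := by
    apply ModuleCat.hom_ext
    exact LinearMap.ext fun z => δ_shape _ _ h z
  d_comp_d' i j k _ _ := by
    apply ModuleCat.hom_ext
    exact LinearMap.ext fun z => δ_δ i j k z

open CochainComplex HomComplex in
/-- The dg-category `DgMod(K)` of dg `K`-modules, that is, of complexes of `K`-modules. -/
abbrev dgModK (K : Type u) [CommRing K] : DgCategory.{u, max u (w+1), w} K where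
  Obj := CochainComplex (ModuleCat.{w} K) ℤ
  Hom M N := homComplex M N
  id M := Cochain.ofHom (𝟙 M)
  comp {X Y Z i j n} h := LinearMap.mk₂ K (fun (g : Cochain Y Z i) (f : Cochain X Y j) =>
      f.comp g ((add_comm j i).trans h))
    (fun _ _ _ => Cochain.comp_add _ _ _ _) (fun _ _ _ => Cochain.comp_smul _ _ _ _)
    (fun _ _ _ => Cochain.add_comp _ _ _ _) (fun _ _ _ => Cochain.smul_comp _ _ _ _)
  id_comp {X Y n} f := Cochain.comp_id (F := X) (G := Y) f
  comp_id {X Y n} f := Cochain.id_comp (F := X) (G := Y) f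
  assoc {W X Y Z i j k a b n} hij hjk h h' f g e :=
   (Cochain.comp_assoc (F := W) (G := X) (K := Y) (L := Z) e g f (by omega) (by omega) (by omega)).symm
  leibniz {X Y Z i j n i' j' n'} h hi hj hn f g :=
   (δ_comp (F := X) (G := Y) (K := Z) g f (by omega) _ _ _ hn hj hi)

/-- A dg-functor: `K`-linear maps of degree zero on the Hom-complexes that respect units,
composition and the differential. -/
structure DgFunctor {K : Type u} [CommRing K] (C : DgCategory.{u, o, w} K)
    (D : DgCategory.{u, o', w'} K) where
  obj : C.Obj → D.Obj
  map {X Y : C.Obj} {n : ℤ} : (C.Hom X Y).X n →ₗ[K] (D.Hom (obj X) (obj Y)).X n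
  map_id (X : C.Obj) : map (C.id X) = D.id (obj X)
  map_comp {X Y Z : C.Obj} {i j n : ℤ} (h : i + j = n)
    (f : (C.Hom Y Z).X i) (g : (C.Hom X Y).X j) :
    map (C.comp h f g) = D.comp h (map f) (map g)
  map_d {X Y : C.Obj} {n n' : ℤ} (h : n + 1 = n') (f : (C.Hom X Y).X n) :
    map (C.d n n' f) = D.d n n' (map f)

section
variable {K : Type u} [CommRing K]

/-- A family of linear maps `M^p → N^q`, for `p + n = q`, as a morphism of degree `n` of
`dgModK K`. -/
def mkHom {M N : CochainComplex (ModuleCat.{w} K) ℤ} {n : ℤ}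
    (φ : ∀ p q : ℤ, p + n = q → (M.X p →ₗ[K] N.X q)) : ((dgModK K).Hom M N).X n :=
  CochainComplex.HomComplex.Cochain.mk fun p q h => ModuleCat.ofHom (φ p q h)

/-- The component `M^p → N^q`, for `p + n = q`, of a morphism of degree `n` of `dgModK K`. -/
def app {M N : CochainComplex (ModuleCat.{w} K) ℤ} {n : ℤ} (f : ((dgModK K).Hom M N).X n)
    (p q : ℤ) (h : p + n = q) : M.X p →ₗ[K] N.X q :=
  (CochainComplex.HomComplex.Cochain.v (F := M) (G := N) f p q h).hom

variable {L M N : CochainComplex (ModuleCat.{w} K) ℤ} {n : ℤ}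

theorem app_mkHom (φ : ∀ p q : ℤ, p + n = q → (M.X p →ₗ[K] N.X q)) (p q : ℤ) (h : p + n = q) :
    app (mkHom φ) p q h = φ p q h := rfl

theorem app_ext {f g : ((dgModK K).Hom M N).X n}
    (h : ∀ (p q : ℤ) (hpq : p + n = q) (x : M.X p), app f p q hpq x = app g p q hpq x) :
    f = g := by
  apply CochainComplex.HomComplex.Cochain.ext (F := M) (G := N)
  intro p q hpq
  apply ModuleCat.hom_ext
  exact LinearMap.ext (h p q hpq)

theorem app_add (f g : ((dgModK K).Hom M N).X n) (p q : ℤ) (h : p + n = q) (x : M.X p) :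
    app (f + g) p q h x = app f p q h x + app g p q h x := rfl

theorem app_smul (c : K) (f : ((dgModK K).Hom M N).X n) (p q : ℤ) (h : p + n = q) (x : M.X p) :
    app (c • f) p q h x = c • app f p q h x := rfl

theorem app_zero (p q : ℤ) (h : p + n = q) (x : M.X p) :
    app (0 : ((dgModK K).Hom M N).X n) p q h x = 0 := rfl

theorem app_sign (s : ℤˣ) (f : ((dgModK K).Hom M N).X n) (p q : ℤ) (h : p + n = q) (x : M.X p) :
    app (s • f) p q h x = s • app f p q h x :=
  map_sign (K := K) ({ toFun := fun f => app f p q h x, map_add' := fun _ _ => rfl, map_smul' := fun _ _ => rfl } : ((dgModK K).Hom M N).X n →ₗ[K] N.X q) s f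

theorem app_id (p : ℤ) (x : M.X p) (h : p + 0 = p) : app ((dgModK K).id M) p p h x = x := by
  unfold app
  erw [CochainComplex.HomComplex.Cochain.ofHom_v]
  rfl

theorem app_comp {i j : ℤ} (h : i + j = n) (g : ((dgModK K).Hom M N).X i)
    (f : ((dgModK K).Hom L M).X j) (p q r : ℤ) (hpq : p + j = q) (hqr : q + i = r)
    (hpr : p + n = r) (x : L.X p) :
    app ((dgModK K).comp h g f) p r hpr x = app g q r hqr (app f p q hpq x) := by
  have := CochainComplex.HomComplex.Cochain.comp_v (F := L) (G := M) (K := N) f g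
    ((add_comm j i).trans h) p q r hpq hqr
  exact congrArg (fun φ => φ.hom x) this

theorem app_d {n' : ℤ} (hn : n + 1 = n') (f : ((dgModK K).Hom M N).X n)
    (p p' q q' : ℤ) (hp : p + 1 = p') (hpq : p + n = q) (hq : p + n' = q') (hpq' : p' + n = q') (x : M.X p) :
    app ((dgModK K).d n n' f) p q' hq x =
      (N.d q q').hom (app f p q hpq x) -
        n.negOnePow • app f p' q' hpq' ((M.d p p').hom x) := by
  have := CochainComplex.HomComplex.δ_v (F := M) (G := N) n n' hn f p q' hq q p' (by omega) hp
  have e := congrArg (fun φ => φ.hom x) this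
  have e2 : app ((dgModK K).d n n' f) p q' hq x =
      (N.d q q').hom (app f p q hpq x) +
        n'.negOnePow • app f p' q' hpq' ((M.d p p').hom x) := e
  rw [e2, ← hn, Int.negOnePow_succ, sub_eq_add_neg, Units.neg_smul]

end

section
variable {K : Type u} [CommRing K] {C : DgCategory.{u, o, w} K} {D : DgCategory.{u, o', w'} K}

theorem DgCategory.d_shape {X Y : C.Obj} {n n' : ℤ} (h : ¬ n + 1 = n') (f : (C.Hom X Y).X n) :
    C.d n n' f = 0 := by
  have : (C.Hom X Y).d n n' = 0 := (C.Hom X Y).shape n n' h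
  simp [DgCategory.d, this]

theorem DgCategory.d_d {X Y : C.Obj} (n n' n'' : ℤ) (f : (C.Hom X Y).X n) :
    C.d n' n'' (C.d n n' f) = 0 := by
  have : (C.Hom X Y).d n n' ≫ (C.Hom X Y).d n' n'' = 0 := (C.Hom X Y).d_comp_d n n' n''
  exact congrArg (fun φ => φ.hom f) this

theorem DgCategory.d_id (X : C.Obj) : C.d 0 1 (C.id X) = 0 := by
  have h := C.leibniz (zero_add 0) (zero_add 1) (zero_add 1) (zero_add 1) (C.id X) (C.id X)
  rw [C.comp_id, C.comp_id] at h
  have h2 := C.id_comp (C.d 0 1 (C.id X))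
  simpa [h2] using h

/-- The dg-natural transformations `η : F → G` of degree `n`: families of morphisms
`η_X : F(X) → G(X)` of degree `n` with `G(f) η_X = (-1)^{nm} η_Y F(f)` for `f : X → Y` of
degree `m`. -/
def dgNat (F G : DgFunctor C D) (n : ℤ) :
    Submodule K (∀ X : C.Obj, (D.Hom (F.obj X) (G.obj X)).X n) where
  carrier := {η | ∀ {m l : ℤ} (h : m + n = l) {X Y : C.Obj} (f : (C.Hom X Y).X m),
    D.comp h (G.map f) (η X) =
      (n * m).negOnePow • D.comp ((add_comm n m).trans h) (η Y) (F.map f)}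
  zero_mem' := by
    intro m l h X Y f
    simp
  add_mem' := by
    intro a b ha hb m l h X Y f
    simp only [Pi.add_apply, map_add, LinearMap.add_apply, smul_add]
    rw [ha, hb]
  smul_mem' := by
    intro c a ha m l h X Y f
    simp only [Pi.smul_apply, map_smul, LinearMap.smul_apply]
    rw [ha, smul_comm]

theorem dgNat_d {F G : DgFunctor C D} (n n' : ℤ)
    (η : ∀ X : C.Obj, (D.Hom (F.obj X) (G.obj X)).X n) (hη : η ∈ dgNat F G n) :
    (fun X => D.d n n' (η X)) ∈ dgNat F G n' := by
  intro m l hl X Y f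
  by_cases h : n + 1 = n'
  · subst h
    have h1 := congrArg (D.d (m + n) l) (hη rfl f)
    have h2 := hη (m := m + 1) (l := l) (by omega) (C.d m (m + 1) f)
    have hs := D.leibniz (add_comm n m) rfl rfl (show m + n + 1 = l by omega) (η Y) (F.map f)
    rw [D.leibniz rfl rfl rfl (by omega), map_sign, hs] at h1
    rw [G.map_d rfl, F.map_d rfl] at h2
    rw [h2, smul_add, smul_smul, ← Int.negOnePow_add, add_comm,
      sign_congr (a := n * (m + 1)) (b := n * m + n) _ ⟨0, by ring⟩] at h1
    have h3 := congrArg (fun x => m.negOnePow • x) (add_right_cancel h1)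
    simp only [smul_smul, ← Int.negOnePow_add] at h3
    rw [sign_congr (a := m + m) (b := 0) _ ⟨m, by ring⟩, Int.negOnePow_zero, one_smul] at h3
    rw [h3]
    exact sign_congr _ ⟨0, by ring⟩
  · simp only [D.d_shape h, map_zero, LinearMap.zero_apply, smul_zero]

/-- The complex of dg-natural transformations, with `d(η)_X = d(η_X)`. -/
def dgNatComplex (F G : DgFunctor C D) : CochainComplex (ModuleCat.{max o w'} K) ℤ where
  X n := ModuleCat.of K (dgNat F G n)
  d n n' := ModuleCat.ofHom (LinearMap.restrict
    (LinearMap.pi fun X => D.d n n' ∘ₗ LinearMap.proj X) (dgNat_d n n'))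
  shape n n' h := by
    apply ModuleCat.hom_ext
    refine LinearMap.ext fun η => Subtype.ext (funext fun X => ?_)
    exact D.d_shape h _
  d_comp_d' n n' n'' _ _ := by
    apply ModuleCat.hom_ext
    refine LinearMap.ext fun η => Subtype.ext (funext fun X => ?_)
    exact D.d_d _ _ _ _

theorem dgNat_comp {F G H : DgFunctor C D} {i j n : ℤ} (h : i + j = n)
    {η : ∀ X : C.Obj, (D.Hom (G.obj X) (H.obj X)).X i} (hη : η ∈ dgNat G H i)
    {θ : ∀ X : C.Obj, (D.Hom (F.obj X) (G.obj X)).X j} (hθ : θ ∈ dgNat F G j) :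
    (fun X => D.comp h (η X) (θ X)) ∈ dgNat F H n := by
  intro m l hl X Y f
  subst h
  rw [← D.assoc (a := m + i) rfl rfl (by omega) hl, hη rfl, map_sign, LinearMap.smul_apply, D.assoc (b := m + j) _ rfl _ (by omega), hθ rfl,
    map_sign, smul_smul, ← Int.negOnePow_add,
    D.assoc (b := m + j) rfl (add_comm j m) _ (by omega), ← add_mul]

/-- The objectwise composition of dg-natural transformations. -/
def dgNatComp (F G H : DgFunctor C D) {i j n : ℤ} (h : i + j = n) :
    dgNat G H i →ₗ[K] dgNat F G j →ₗ[K] dgNat F H n :=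
  LinearMap.mk₂ K
    (fun η θ => ⟨fun X => D.comp h (η.1 X) (θ.1 X), dgNat_comp h η.2 θ.2⟩)
    (fun _ _ _ => Subtype.ext (funext fun X => by simp))
    (fun _ _ _ => Subtype.ext (funext fun X => by simp))
    (fun _ _ _ => Subtype.ext (funext fun X => by simp))
    (fun _ _ _ => Subtype.ext (funext fun X => by simp))

/-- The dg-category of dg-functors from `C` to `D`. -/
abbrev dgFun (C : DgCategory.{u, o, w} K) (D : DgCategory.{u, o', w'} K) :
    DgCategory.{u, max o w o' w', max o w'} K where
  Obj := DgFunctor C D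
  Hom F G := dgNatComplex F G
  id F := (⟨fun X => D.id (F.obj X), by
    intro m l h X Y f
    obtain rfl : m = l := by omega
    rw [D.comp_id, D.id_comp, zero_mul, Int.negOnePow_zero, one_smul]⟩ : dgNat F F 0)
  comp {F G H i j n} h := dgNatComp F G H h
  id_comp η := Subtype.ext (funext fun X => D.id_comp _)
  comp_id η := Subtype.ext (funext fun X => D.comp_id _)
  assoc hij hjk h h' η θ κ := Subtype.ext (funext fun X => D.assoc hij hjk h h' _ _ _)
  leibniz h hi hj hn η θ := Subtype.ext (funext fun X => D.leibniz h hi hj hn _ _)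
end

section
variable {K : Type u} [CommRing K] {C : DgCategory.{u, o, w} K} {D : DgCategory.{u, o', w'} K}

/-- The component at `X` of a morphism of degree `n` of `dgFun C D`. -/
def natApp {F G : DgFunctor C D} {n : ℤ} (η : ((dgFun C D).Hom F G).X n) (X : C.Obj) :
    (D.Hom (F.obj X) (G.obj X)).X n :=
  Subtype.val (p := fun η => η ∈ dgNat F G n) η X

/-- The morphism of degree `n` of `dgFun C D` with given components. -/
def mkNat {F G : DgFunctor C D} {n : ℤ} (η : ∀ X : C.Obj, (D.Hom (F.obj X) (G.obj X)).X n)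
    (hη : η ∈ dgNat F G n) : ((dgFun C D).Hom F G).X n :=
  (⟨η, hη⟩ : dgNat F G n)

variable {F G H : DgFunctor C D} {n : ℤ}

theorem natApp_mkNat (η : ∀ X : C.Obj, (D.Hom (F.obj X) (G.obj X)).X n)
    (hη : η ∈ dgNat F G n) (X : C.Obj) : natApp (mkNat η hη) X = η X := rfl

theorem natApp_ext {η θ : ((dgFun C D).Hom F G).X n} (h : ∀ X, natApp η X = natApp θ X) :
    η = θ := Subtype.ext (funext h)

theorem natApp_mem (η : ((dgFun C D).Hom F G).X n) : natApp η ∈ dgNat F G n :=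
  Subtype.property (p := fun η => η ∈ dgNat F G n) η

theorem natApp_nat (η : ((dgFun C D).Hom F G).X n) {m l : ℤ} (h : m + n = l) {X Y : C.Obj}
    (f : (C.Hom X Y).X m) : D.comp h (G.map f) (natApp η X) =
      (n * m).negOnePow • D.comp ((add_comm n m).trans h) (natApp η Y) (F.map f) :=
  natApp_mem η h f

theorem natApp_add (η θ : ((dgFun C D).Hom F G).X n) (X : C.Obj) :
    natApp (η + θ) X = natApp η X + natApp θ X := rfl

theorem natApp_smul (c : K) (η : ((dgFun C D).Hom F G).X n) (X : C.Obj) :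
    natApp (c • η) X = c • natApp η X := rfl

theorem natApp_sign (s : ℤˣ) (η : ((dgFun C D).Hom F G).X n) (X : C.Obj) :
    natApp (s • η) X = s • natApp η X :=
  map_sign (K := K) ({ toFun := fun η => natApp η X, map_add' := fun _ _ => rfl, map_smul' := fun _ _ => rfl } : ((dgFun C D).Hom F G).X n →ₗ[K] (D.Hom (F.obj X) (G.obj X)).X n) s η

theorem natApp_id (X : C.Obj) : natApp ((dgFun C D).id F) X = D.id (F.obj X) := rfl

theorem natApp_comp {i j : ℤ} (h : i + j = n) (η : ((dgFun C D).Hom G H).X i)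
    (θ : ((dgFun C D).Hom F G).X j) (X : C.Obj) :
    natApp ((dgFun C D).comp h η θ) X = D.comp h (natApp η X) (natApp θ X) := rfl

theorem natApp_d (n n' : ℤ) (η : ((dgFun C D).Hom F G).X n) (X : C.Obj) :
    natApp ((dgFun C D).d n n' η) X = D.d n n' (natApp η X) := rfl

end

/-- The dg-category `DgMod(C)` of (left) dg-modules over a small dg-category `C`, that is, of
dg-functors `C → DgMod(K)`. -/
abbrev dgMod {K : Type u} [CommRing K] (C : DgCategory.{u, w, w} K) :
    DgCategory.{u, max u (w + 1), w} K :=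
  dgFun C (dgModK.{u, w} K)

namespace DgFunctor
variable {K : Type u} [CommRing K]

/-- The identity dg-functor. -/
protected def id (C : DgCategory.{u, o, w} K) : DgFunctor C C where
  obj X := X
  map := LinearMap.id
  map_id _ := rfl
  map_comp _ _ _ := rfl
  map_d _ _ := rfl

/-- The composite `G ∘ F` of dg-functors. -/
def comp {C : DgCategory.{u, o, w} K} {D : DgCategory.{u, o', w'} K}
    {E : DgCategory.{u, o'', w''} K} (G : DgFunctor D E) (F : DgFunctor C D) : DgFunctor C E where
  obj X := G.obj (F.obj X)
  map := G.map ∘ₗ F.map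
  map_id X := by simp [F.map_id, G.map_id]
  map_comp h f g := by simp [F.map_comp h, G.map_comp h]
  map_d h f := by
    rw [LinearMap.comp_apply, F.map_d h, G.map_d h]
    rfl

/-- The dg-functor `F ↦ F ∘ E` given by precomposition with `E : C → C'`. -/
def precomp {C : DgCategory.{u, o, w} K} {C' : DgCategory.{u, o'', w''} K}
    (E : DgFunctor C C') (D : DgCategory.{u, o', w'} K) : DgFunctor (dgFun C' D) (dgFun C D) where
  obj F := F.comp E
  map {F G _} :=
    { toFun := fun η => mkNat (F := F.comp E) (G := G.comp E) (fun X => natApp η (E.obj X))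
        fun {_ _} h {_ _} f => natApp_nat η h (E.map f)
      map_add' := fun _ _ => rfl
      map_smul' := fun _ _ => rfl }
  map_id _ := rfl
  map_comp _ _ _ := rfl
  map_d _ _ := rfl

/-- The representable dg-functor `Hom(A, -)`, with `f` acting by `x ↦ f ∘ x`. -/
def homFrom (C : DgCategory.{u, o, w} K) (A : C.Obj) : DgFunctor C (dgModK.{u, w} K) where
  obj X := C.Hom A X
  map {X Y n} :=
    { toFun := fun f => mkHom fun p q h => C.comp ((add_comm n p).trans h) f
      map_add' := fun f g => app_ext fun p q h x =>
        congrArg (fun φ => φ x) (map_add (C.comp ((add_comm n p).trans h)) f g)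
      map_smul' := fun c f => app_ext fun p q h x =>
        congrArg (fun φ => φ x) (map_smul (C.comp ((add_comm n p).trans h)) c f) }
  map_id X := app_ext fun p q h x => by
    obtain rfl : p = q := by omega
    rw [app_id]
    exact C.id_comp x
  map_comp {X Y Z i j n} h f g := app_ext fun p q hpq x => by
    rw [app_comp h _ _ p (p + j) q rfl (by omega) hpq]
    exact C.assoc h (by omega) (by omega) (by omega) f g x
  map_d {X Y n n'} h f := app_ext fun p q hpq x => by
    rw [app_d h _ p (p + 1) (p + n) q rfl rfl hpq (by omega)]
    have := C.leibniz (n := p + n) (by omega) h rfl (show p + n + 1 = q by omega) f x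
    exact eq_sub_of_add_eq this.symm

/-- The dg-natural transformation `Hom(-, B) → Hom(-, B')`, `x ↦ e ∘ x`, given by `e : B → B'`. -/
def yonedaApp (C : DgCategory.{u, o, w} K) {B B' : C.Obj} {n : ℤ} (e : (C.Hom B B').X n)
    (X : C.Obj) : ((dgModK.{u, w} K).Hom (C.Hom X B) (C.Hom X B')).X n :=
  mkHom fun p _ h => C.comp ((add_comm n p).trans h) e

theorem yonedaApp_mem (C : DgCategory.{u, o, w} K) {B B' : C.Obj} {n : ℤ}
    (e : (C.Hom B B').X n) :
    yonedaApp C e ∈ dgNat (homFrom C.op B) (homFrom C.op B') n := by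
  intro m l h X Y f
  refine app_ext fun p q hpq x => ?_
  have e1 := app_comp h ((homFrom C.op B').map f) (yonedaApp C e X) p (p + n) q rfl
    (by omega) hpq x
  have e2 := app_comp ((add_comm n m).trans h) (yonedaApp C e Y) ((homFrom C.op B).map f)
    p (p + m) q rfl (by omega) hpq x
  refine e1.trans (Eq.trans ?_ (app_sign _ _ _ _ _ _).symm)
  refine Eq.trans ?_ (congrArg _ e2.symm)
  have key : ∀ (x : (C.Hom X B).X p) (f : (C.Hom (Y : C.Obj) X).X m),
      (m * (p + n)).negOnePow • C.comp (i := p + n) (n := q) (by omega)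
        (C.comp (j := p) (by omega) e x) f =
      (n * m).negOnePow • C.comp (j := p + m) (by omega) e
        ((m * p).negOnePow • C.comp (by omega) x f) := by
    intro x f
    rw [map_sign, smul_smul, ← Int.negOnePow_add,
      C.assoc (b := p + m) (by omega) (by omega) (by omega) (by omega)]
    exact sign_congr _ ⟨0, by ring⟩
  exact key x f

/-- The Yoneda dg-functor `B ↦ Hom(-, B)`, a dg-functor from `C` to the dg-functors
`C^op → DgMod(K)`. Here `f^op` acts on `Hom(-, B)` by `x ↦ (-1)^{|f||x|} x ∘ f`. -/
def yoneda (C : DgCategory.{u, o, w} K) : DgFunctor C (dgFun C.op (dgModK.{u, w} K)) where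
  obj B := homFrom C.op B
  map {B B' n} :=
    { toFun := fun e => mkNat (F := homFrom C.op B) (G := homFrom C.op B') (yonedaApp C e)
        (yonedaApp_mem C e)
      map_add' := fun f g => natApp_ext fun X => app_ext fun p q h x =>
        congrArg (fun φ => φ x) (map_add (C.comp ((add_comm n p).trans h)) f g)
      map_smul' := fun c f => natApp_ext fun X => app_ext fun p q h x =>
        congrArg (fun φ => φ x) (map_smul (C.comp ((add_comm n p).trans h)) c f) }
  map_id B := natApp_ext fun X => app_ext fun p q h x => by
    obtain rfl : p = q := by omega
    exact (C.id_comp x).trans (app_id (M := C.Hom X B) p x h).symm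
  map_comp {X Y Z i j n} h f g := natApp_ext fun A => app_ext fun p q hpq x => by
    have e := app_comp h (yonedaApp C f A) (yonedaApp C g A) p (p + j) q rfl (by omega) hpq x
    refine Eq.trans ?_ e.symm
    exact C.assoc h (by omega) (by omega) (by omega) f g x
  map_d {X Y n n'} h f := natApp_ext fun A => app_ext fun p q hpq x => by
    have e := app_d h (yonedaApp C f A) p (p + 1) (p + n) q rfl rfl hpq (by omega) x
    refine Eq.trans ?_ e.symm
    have := C.leibniz (n := p + n) (by omega) h rfl (show p + n + 1 = q by omega) f x
    exact eq_sub_of_add_eq this.symm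

end DgFunctor

section comma
variable {K : Type u} [CommRing K] {C : DgCategory.{u, o, w} K} {D : DgCategory.{u, o', w'} K}

/-- An object `(A, f, B)` of the comma dg-category `(D, F C)` of a dg-functor `F : C → D`: objects
`A` of `D` and `B` of `C`, and a closed morphism `f : A → F(B)` of degree zero. -/
structure CommaObj (F : DgFunctor C D) where
  left : D.Obj
  right : C.Obj
  hom : (D.Hom left (F.obj right)).X 0
  closed : D.d 0 1 hom = 0

/-- The morphisms `(A, f, B) → (A', f', B')` of degree `n`: the pairs `(α, β)` of morphisms
`α : A → A'` and `β : B → B'` of degree `n` with `f' α = F(β) f`. -/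
def commaHom (F : DgFunctor C D) (P Q : CommaObj F) (n : ℤ) :
    Submodule K ((D.Hom P.left Q.left).X n × (C.Hom P.right Q.right).X n) where
  carrier := {γ | D.comp (zero_add n) Q.hom γ.1 = D.comp (add_zero n) (F.map γ.2) P.hom}
  zero_mem' := by simp
  add_mem' := by
    intro a b ha hb
    simp only [Set.mem_ofPred_eq, Prod.fst_add, Prod.snd_add, map_add, LinearMap.add_apply] at *
    rw [ha, hb]
  smul_mem' := by
    intro c a ha
    simp only [Set.mem_ofPred_eq, Prod.smul_fst, Prod.smul_snd, map_smul, LinearMap.smul_apply] at *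
    rw [ha]

theorem commaHom_d {F : DgFunctor C D} {P Q : CommaObj F} (n n' : ℤ)
    (γ : (D.Hom P.left Q.left).X n × (C.Hom P.right Q.right).X n) (hγ : γ ∈ commaHom F P Q n) :
    LinearMap.prodMap (D.d n n') (C.d n n') γ ∈ commaHom F P Q n' := by
  by_cases h : n + 1 = n'
  · have h1 := congrArg (D.d n n') hγ
    rw [D.leibniz (zero_add n) rfl h h, D.leibniz (add_zero n) h (zero_add 1) h] at h1
    have h2 : D.d 0 (0 + 1) Q.hom = 0 := Q.closed
    have h3 : D.d 0 1 P.hom = 0 := P.closed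
    rw [h2, h3] at h1
    simp only [map_zero, LinearMap.zero_apply, smul_zero, zero_add, add_zero, Int.negOnePow_zero, one_smul] at h1
    refine h1.trans ?_
    have := F.map_d h γ.2
    exact congrArg (fun x => D.comp (add_zero n') x P.hom) this.symm
  · have h1 : LinearMap.prodMap (D.d n n') (C.d n n') γ = 0 :=
      Prod.ext (D.d_shape h γ.1) (C.d_shape h γ.2)
    rw [h1]
    exact Submodule.zero_mem _

/-- The Hom-complex of the comma dg-category, with `d(α, β) = (d(α), d(β))`. -/
def commaComplex (F : DgFunctor C D) (P Q : CommaObj F) :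
    CochainComplex (ModuleCat.{max w w'} K) ℤ where
  X n := ModuleCat.of K (commaHom F P Q n)
  d n n' := ModuleCat.ofHom (LinearMap.restrict
    (LinearMap.prodMap (D.d n n') (C.d n n')) (commaHom_d n n'))
  shape n n' h := by
    apply ModuleCat.hom_ext
    exact LinearMap.ext fun γ => Subtype.ext (Prod.ext (D.d_shape h _) (C.d_shape h _))
  d_comp_d' n n' n'' _ _ := by
    apply ModuleCat.hom_ext
    exact LinearMap.ext fun γ => Subtype.ext (Prod.ext (D.d_d _ _ _ _) (C.d_d _ _ _ _))

theorem commaHom_comp {F : DgFunctor C D} {P Q R : CommaObj F} {i j n : ℤ} (h : i + j = n)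
    {γ : (D.Hom Q.left R.left).X i × (C.Hom Q.right R.right).X i} (hγ : γ ∈ commaHom F Q R i)
    {κ : (D.Hom P.left Q.left).X j × (C.Hom P.right Q.right).X j} (hκ : κ ∈ commaHom F P Q j) :
    (D.comp h γ.1 κ.1, C.comp h γ.2 κ.2) ∈ commaHom F P R n := by
  have h1 : D.comp (zero_add i) R.hom γ.1 = D.comp (add_zero i) (F.map γ.2) Q.hom := hγ
  have h2 : D.comp (zero_add j) Q.hom κ.1 = D.comp (add_zero j) (F.map κ.2) P.hom := hκ
  change D.comp _ R.hom (D.comp h γ.1 κ.1) = D.comp _ (F.map (C.comp h γ.2 κ.2)) P.hom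
  rw [F.map_comp h, ← D.assoc (zero_add i) h h, h1, D.assoc (add_zero i) (zero_add j) h h, h2,
    ← D.assoc h (add_zero j) (add_zero n) h]

/-- The componentwise composition in the comma dg-category. -/
def commaComp (F : DgFunctor C D) (P Q R : CommaObj F) {i j n : ℤ} (h : i + j = n) :
    commaHom F Q R i →ₗ[K] commaHom F P Q j →ₗ[K] commaHom F P R n :=
  LinearMap.mk₂ K
    (fun γ κ => ⟨(D.comp h γ.1.1 κ.1.1, C.comp h γ.1.2 κ.1.2), commaHom_comp h γ.2 κ.2⟩)
    (fun _ _ _ => Subtype.ext (by simp))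
    (fun _ _ _ => Subtype.ext (by simp))
    (fun _ _ _ => Subtype.ext (by simp))
    (fun _ _ _ => Subtype.ext (by simp))

/-- The comma dg-category `(D, F C)` of a dg-functor `F : C → D`. -/
abbrev dgComma (F : DgFunctor C D) : DgCategory.{u, max o o' w', max w w'} K where
  Obj := CommaObj F
  Hom P Q := commaComplex F P Q
  id P := (⟨(D.id P.left, C.id P.right), by
    change D.comp _ P.hom (D.id P.left) = D.comp _ (F.map (C.id P.right)) P.hom
    rw [F.map_id, D.comp_id, D.id_comp]⟩ : commaHom F P P 0)
  comp {P Q R i j n} h := commaComp F P Q R h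
  id_comp γ := Subtype.ext (Prod.ext (D.id_comp _) (C.id_comp _))
  comp_id γ := Subtype.ext (Prod.ext (D.comp_id _) (C.comp_id _))
  assoc hij hjk h h' _ _ _ :=
    Subtype.ext (Prod.ext (D.assoc hij hjk h h' _ _ _) (C.assoc hij hjk h h' _ _ _))
  leibniz h hi hj hn _ _ :=
    Subtype.ext (Prod.ext (D.leibniz h hi hj hn _ _) (C.leibniz h hi hj hn _ _))

end comma

section tensor
variable {K : Type u} [CommRing K]

/-- The degree-`n` part `⨁_{i + j = n} A^i ⊗ B^j` of the tensor product of complexes. -/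
abbrev tensorX (A B : CochainComplex (ModuleCat.{w} K) ℤ) (n : ℤ) : Type w :=
  DirectSum {p : ℤ × ℤ // p.1 + p.2 = n} fun p => A.X p.1.1 ⊗[K] B.X p.1.2

variable {A B : CochainComplex (ModuleCat.{w} K) ℤ} {V : Type w'} [AddCommGroup V] [Module K V]

/-- The homogeneous tensor `a ⊗ b`. -/
def tmul {i j n : ℤ} (h : i + j = n) : A.X i →ₗ[K] B.X j →ₗ[K] tensorX A B n :=
  (TensorProduct.mk K (A.X i) (B.X j)).compr₂
    (DirectSum.lof K {p : ℤ × ℤ // p.1 + p.2 = n} (fun p => A.X p.1.1 ⊗[K] B.X p.1.2)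
      ⟨(i, j), h⟩)

/-- The linear map out of the tensor product given by bilinear maps on homogeneous elements. -/
def tensorLift {n : ℤ} (φ : ∀ i j : ℤ, i + j = n → (A.X i →ₗ[K] B.X j →ₗ[K] V)) :
    tensorX A B n →ₗ[K] V :=
  DirectSum.toModule K _ V fun p => TensorProduct.lift (φ p.1.1 p.1.2 p.2)

theorem tensorLift_tmul {n : ℤ} (φ : ∀ i j : ℤ, i + j = n → (A.X i →ₗ[K] B.X j →ₗ[K] V))
    {i j : ℤ} (h : i + j = n) (a : A.X i) (b : B.X j) :
    tensorLift φ (tmul h a b) = φ i j h a b := by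
  simp [tensorLift, tmul]

theorem tensor_hom_ext {n : ℤ} {f g : tensorX A B n →ₗ[K] V}
    (H : ∀ (i j : ℤ) (h : i + j = n) (a : A.X i) (b : B.X j), f (tmul h a b) = g (tmul h a b)) :
    f = g := by
  refine DirectSum.linearMap_ext K fun p => TensorProduct.ext' fun a b => ?_
  exact H p.1.1 p.1.2 p.2 a b

theorem tensor_induction {n : ℤ} {P : tensorX A B n → Prop} (x : tensorX A B n)
    (h0 : P 0) (hadd : ∀ y z, P y → P z → P (y + z))
    (H : ∀ (i j : ℤ) (h : i + j = n) (a : A.X i) (b : B.X j), P (tmul h a b)) : P x := by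
  refine DirectSum.induction_on x h0 ?_ hadd
  intro p y
  refine TensorProduct.induction_on y ?_ ?_ ?_
  · rw [map_zero]
    exact h0
  · exact fun a b => H p.1.1 p.1.2 p.2 a b
  · intro y z hy hz
    rw [map_add]
    exact hadd _ _ hy hz

/-- The differential `d(a ⊗ b) = d(a) ⊗ b + (-1)^{|a|} a ⊗ d(b)`. -/
def tensorD (A B : CochainComplex (ModuleCat.{w} K) ℤ) (n n' : ℤ) :
    tensorX A B n →ₗ[K] tensorX A B n' :=
  if hn : n + 1 = n' then
    tensorLift fun i j h =>
      (tmul (i := i + 1) (j := j) (by omega)).comp (A.d i (i + 1)).hom +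
        i.negOnePow • (tmul (i := i) (j := j + 1) (by omega)).compl₂ (B.d j (j + 1)).hom
  else 0

theorem tensorD_tmul {n n' i j i' j' : ℤ} (hn : n + 1 = n') (hi : i + 1 = i') (hj : j + 1 = j')
    (h : i + j = n) (a : A.X i) (b : B.X j) :
    tensorD A B n n' (tmul h a b) =
      tmul (by omega) ((A.d i i').hom a) b +
        i.negOnePow • tmul (by omega) a ((B.d j j').hom b) := by
  subst hn hi hj
  rw [tensorD, dif_pos rfl, tensorLift_tmul]
  rfl

theorem hom_d_d (A : CochainComplex (ModuleCat.{w} K) ℤ) (i j k : ℤ) (a : A.X i) :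
    (A.d j k).hom ((A.d i j).hom a) = 0 :=
  congrArg (fun φ => φ.hom a) (A.d_comp_d i j k)

/-- The tensor product of complexes of `K`-modules. -/
def tensorComplex (A B : CochainComplex (ModuleCat.{w} K) ℤ) :
    CochainComplex (ModuleCat.{w} K) ℤ where
  X n := ModuleCat.of K (tensorX A B n)
  d n n' := ModuleCat.ofHom (tensorD A B n n')
  shape n n' h := by
    have : tensorD A B n n' = 0 := dif_neg h
    rw [this]
    rfl
  d_comp_d' n n' n'' h h' := by
    have h : n + 1 = n' := h
    have h' : n' + 1 = n'' := h'
    apply ModuleCat.hom_ext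
    refine tensor_hom_ext fun i j hij a b => ?_
    change tensorD A B n' n'' (tensorD A B n n' (tmul hij a b)) = 0
    rw [tensorD_tmul h rfl rfl, map_add, map_sign, tensorD_tmul h' rfl rfl,
      tensorD_tmul h' rfl rfl, hom_d_d, hom_d_d, map_zero, map_zero, LinearMap.zero_apply,
      smul_zero, add_zero, zero_add, Int.negOnePow_succ, Units.neg_smul, neg_add_cancel]

end tensor

section tensorCat
variable {K : Type u} [CommRing K]

/-- The composition `(a₂ ⊗ b₂) ∘ (a₁ ⊗ b₁) = (-1)^{|b₂||a₁|} (a₂ ∘ a₁) ⊗ (b₂ ∘ b₁)`. -/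
def tensorComp (A : DgCategory.{u, o, w} K) (B : DgCategory.{u, o', w} K)
    {X Y Z : A.Obj} {X' Y' Z' : B.Obj} {r s n : ℤ} (h : r + s = n) :
    tensorX (A.Hom Y Z) (B.Hom Y' Z') r →ₗ[K] tensorX (A.Hom X Y) (B.Hom X' Y') s →ₗ[K]
      tensorX (A.Hom X Z) (B.Hom X' Z') n :=
  tensorLift fun i₂ j₂ h₂ => LinearMap.mk₂ K
    (fun a₂ b₂ => tensorLift fun i₁ j₁ h₁ =>
      (j₂ * i₁).negOnePow • (tmul (i := i₂ + i₁) (j := j₂ + j₁) (by omega)).compl₁₂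
        (A.comp rfl a₂) (B.comp rfl b₂))
    (fun _ _ _ => tensor_hom_ext fun _ _ _ _ _ => by simp [tensorLift_tmul])
    (fun _ _ _ => tensor_hom_ext fun _ _ _ _ _ => by
      simp [tensorLift_tmul, smul_comm _ (Int.negOnePow _)])
    (fun _ _ _ => tensor_hom_ext fun _ _ _ _ _ => by simp [tensorLift_tmul])
    (fun _ _ _ => tensor_hom_ext fun _ _ _ _ _ => by
      simp [tensorLift_tmul, smul_comm _ (Int.negOnePow _)])

theorem tensorComp_tmul (A : DgCategory.{u, o, w} K) (B : DgCategory.{u, o', w} K)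
    {X Y Z : A.Obj} {X' Y' Z' : B.Obj} {r s n i₁ j₁ i₂ j₂ i j : ℤ} (h : r + s = n)
    (h₂ : i₂ + j₂ = r) (h₁ : i₁ + j₁ = s) (hi : i₂ + i₁ = i) (hj : j₂ + j₁ = j)
    (a₂ : (A.Hom Y Z).X i₂) (b₂ : (B.Hom Y' Z').X j₂)
    (a₁ : (A.Hom X Y).X i₁) (b₁ : (B.Hom X' Y').X j₁) :
    tensorComp A B h (tmul h₂ a₂ b₂) (tmul h₁ a₁ b₁) =
      (j₂ * i₁).negOnePow • tmul (by omega) (A.comp hi a₂ a₁) (B.comp hj b₂ b₁) := by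
  subst hi hj
  rw [tensorComp, tensorLift_tmul, LinearMap.mk₂_apply, tensorLift_tmul]
  rfl

theorem tensor_id_comp (A : DgCategory.{u, o, w} K) (B : DgCategory.{u, o', w} K)
    {X Y : A.Obj} {X' Y' : B.Obj} {n : ℤ} (f : tensorX (A.Hom X Y) (B.Hom X' Y') n) :
    tensorComp A B (zero_add n) (tmul (add_zero 0) (A.id Y) (B.id Y')) f = f := by
  induction f using tensor_induction with
  | h0 => rw [map_zero]
  | hadd y z hy hz => rw [map_add, hy, hz]
  | H i j h a b =>
    rw [tensorComp_tmul A B _ _ _ (zero_add i) (zero_add j), A.id_comp, B.id_comp, zero_mul,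
      Int.negOnePow_zero, one_smul]

theorem tensor_comp_id (A : DgCategory.{u, o, w} K) (B : DgCategory.{u, o', w} K)
    {X Y : A.Obj} {X' Y' : B.Obj} {n : ℤ} (f : tensorX (A.Hom X Y) (B.Hom X' Y') n) :
    tensorComp A B (add_zero n) f (tmul (add_zero 0) (A.id X) (B.id X')) = f := by
  induction f using tensor_induction with
  | h0 => rw [map_zero, LinearMap.zero_apply]
  | hadd y z hy hz => rw [map_add, LinearMap.add_apply, hy, hz]
  | H i j h a b =>
    rw [tensorComp_tmul A B _ _ _ (add_zero i) (add_zero j), A.comp_id, B.comp_id, mul_zero,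
      Int.negOnePow_zero, one_smul]

theorem tensor_assoc (A : DgCategory.{u, o, w} K) (B : DgCategory.{u, o', w} K)
    {W X Y Z : A.Obj} {W' X' Y' Z' : B.Obj} {r s t a b n : ℤ} (hij : r + s = a) (hjk : s + t = b)
    (h : a + t = n) (h' : r + b = n) (f : tensorX (A.Hom Y Z) (B.Hom Y' Z') r)
    (g : tensorX (A.Hom X Y) (B.Hom X' Y') s) (e : tensorX (A.Hom W X) (B.Hom W' X') t) :
    tensorComp A B h (tensorComp A B hij f g) e =
      tensorComp A B h' f (tensorComp A B hjk g e) := by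
  induction f using tensor_induction with
  | h0 => simp
  | hadd y z hy hz => simp [hy, hz]
  | H i₃ j₃ h₃ a₃ b₃ =>
  induction g using tensor_induction with
  | h0 => simp
  | hadd y z hy hz => simp [hy, hz]
  | H i₂ j₂ h₂ a₂ b₂ =>
  induction e using tensor_induction with
  | h0 => simp
  | hadd y z hy hz => simp [hy, hz]
  | H i₁ j₁ h₁ a₁ b₁ =>
  rw [tensorComp_tmul A B hij h₃ h₂ rfl rfl, tensorComp_tmul A B hjk h₂ h₁ rfl rfl, map_sign₂,
    map_sign, tensorComp_tmul A B h _ h₁ rfl rfl,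
    tensorComp_tmul A B h' h₃ _ (i := i₃ + i₂ + i₁) (j := j₃ + j₂ + j₁) (by ring) (by ring),
    A.assoc rfl rfl rfl (by ring), B.assoc rfl rfl rfl (by ring), smul_smul, smul_smul,
    ← Int.negOnePow_add, ← Int.negOnePow_add]
  exact sign_congr _ ⟨0, by ring⟩

theorem tensor_leibniz (A : DgCategory.{u, o, w} K) (B : DgCategory.{u, o', w} K)
    {X Y Z : A.Obj} {X' Y' Z' : B.Obj} {r s n r' s' n' : ℤ} (h : r + s = n)
    (hr : r + 1 = r') (hs : s + 1 = s') (hn : n + 1 = n')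
    (f : tensorX (A.Hom Y Z) (B.Hom Y' Z') r) (g : tensorX (A.Hom X Y) (B.Hom X' Y') s) :
    tensorD _ _ n n' (tensorComp A B h f g) =
      tensorComp A B (by omega) (tensorD _ _ r r' f) g +
        r.negOnePow • tensorComp A B (by omega) f (tensorD _ _ s s' g) := by
  induction f using tensor_induction with
  | h0 => simp
  | hadd y z hy hz =>
    simp only [map_add, LinearMap.add_apply, smul_add, hy, hz]
    abel
  | H i₂ j₂ h₂ a₂ b₂ =>
  induction g using tensor_induction with
  | h0 => simp
  | hadd y z hy hz =>
    simp only [map_add, smul_add, hy, hz]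
    abel
  | H i₁ j₁ h₁ a₁ b₁ =>
  rw [tensorComp_tmul A B h h₂ h₁ rfl rfl, map_sign, tensorD_tmul hn rfl rfl,
    tensorD_tmul hr rfl rfl, tensorD_tmul hs rfl rfl, map_add, map_add, map_sign,
    LinearMap.add_apply, map_sign₂,
    tensorComp_tmul A B _ _ _ (i := i₂ + i₁ + 1) (j := j₂ + j₁) (by ring) rfl,
    tensorComp_tmul A B _ _ _ (i := i₂ + i₁) (j := j₂ + j₁ + 1) rfl (by ring),
    tensorComp_tmul A B _ _ _ (i := i₂ + i₁ + 1) (j := j₂ + j₁) (by ring) rfl,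
    tensorComp_tmul A B _ _ _ (i := i₂ + i₁) (j := j₂ + j₁ + 1) rfl (by ring),
    A.leibniz rfl rfl rfl rfl, B.leibniz rfl rfl rfl rfl]
  simp only [map_add, map_sign, map_sign₂, LinearMap.add_apply, smul_add, smul_smul,
    ← Int.negOnePow_add]
  rw [sign_congr (a := j₂ * i₁ + i₂) (b := r + j₂ * (i₁ + 1)) _
      ⟨-j₂, by rw [← h₂]; ring⟩,
    sign_congr (a := j₂ * i₁ + (i₂ + i₁)) (b := i₂ + (j₂ + 1) * i₁) _ ⟨0, by ring⟩,
    sign_congr (a := j₂ * i₁ + (i₂ + i₁ + j₂)) (b := r + (i₁ + j₂ * i₁)) _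
      ⟨0, by rw [← h₂]; ring⟩]
  abel

/-- The tensor product `A ⊗ B` of dg-categories. -/
abbrev tensorDg (A : DgCategory.{u, o, w} K) (B : DgCategory.{u, o', w} K) :
    DgCategory.{u, max o o', w} K where
  Obj := A.Obj × B.Obj
  Hom P Q := tensorComplex (A.Hom P.1 Q.1) (B.Hom P.2 Q.2)
  id P := tmul (A := A.Hom P.1 P.1) (B := B.Hom P.2 P.2) (add_zero 0) (A.id P.1) (B.id P.2)
  comp h := tensorComp A B h
  id_comp f := tensor_id_comp A B f
  comp_id f := tensor_comp_id A B f
  assoc hij hjk h h' f g e := tensor_assoc A B hij hjk h h' f g e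
  leibniz h hr hs hn f g := tensor_leibniz A B h hr hs hn f g

end tensorCat

section bimodule
variable {K : Type u} [CommRing K] {T U : DgCategory.{u, w, w} K}

/-- A dg-bimodule `M ∈ DgMod(U ⊗ T^op)`. -/
abbrev DgBimod (U T : DgCategory.{u, w, w} K) := DgFunctor (tensorDg U T.op) (dgModK.{u, w} K)

namespace DgBimod

/-- The action of `f ⊗ 1`, for `f : X → Y` in `U`. -/
def left (M : DgBimod U T) {X Y : U.Obj} (t : T.Obj) {n : ℤ} :
    (U.Hom X Y).X n →ₗ[K] ((dgModK K).Hom (M.obj (X, t)) (M.obj (Y, t))).X n :=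
  M.map (X := (X, t)) (Y := (Y, t)) ∘ₗ
    (tmul (A := U.Hom X Y) (B := T.Hom t t) (add_zero n)).flip (T.id t)

/-- The action of `1 ⊗ f^op`, for `f : s → t` in `T`. -/
def right (M : DgBimod U T) (X : U.Obj) {s t : T.Obj} {n : ℤ} :
    (T.Hom s t).X n →ₗ[K] ((dgModK K).Hom (M.obj (X, t)) (M.obj (X, s))).X n :=
  M.map (X := (X, t)) (Y := (X, s)) ∘ₗ
    tmul (A := U.Hom X X) (B := T.Hom s t) (zero_add n) (U.id X)

theorem left_id (M : DgBimod U T) (X : U.Obj) (t : T.Obj) :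
    M.left t (U.id X) = (dgModK K).id (M.obj (X, t)) := M.map_id (X, t)

theorem right_id (M : DgBimod U T) (X : U.Obj) (t : T.Obj) :
    M.right X (T.id t) = (dgModK K).id (M.obj (X, t)) := M.map_id (X, t)

theorem left_comp (M : DgBimod U T) {X Y Z : U.Obj} (t : T.Obj) {i j n : ℤ} (h : i + j = n)
    (f : (U.Hom Y Z).X i) (g : (U.Hom X Y).X j) :
    M.left t (U.comp h f g) = (dgModK K).comp h (M.left t f) (M.left t g) := by
  refine Eq.trans ?_ (M.map_comp (X := (X, t)) (Y := (Y, t)) (Z := (Z, t)) h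
    (tmul (A := U.Hom Y Z) (B := T.Hom t t) (add_zero i) f (T.id t))
    (tmul (A := U.Hom X Y) (B := T.Hom t t) (add_zero j) g (T.id t)))
  have e := tensorComp_tmul U T.op h (add_zero i) (add_zero j) h (zero_add 0) f (T.id t) g (T.id t)
  rw [zero_mul, Int.negOnePow_zero, one_smul] at e
  have e2 : T.op.comp (zero_add 0) (T.id t) (T.id t) = T.id t := T.op.id_comp (T.id t)
  rw [e2] at e
  exact congrArg (M.map (X := (X, t)) (Y := (Z, t))) e.symm

theorem right_comp (M : DgBimod U T) (X : U.Obj) {r s t : T.Obj} {i j n : ℤ} (h : i + j = n)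
    (f : (T.Hom s t).X i) (g : (T.Hom r s).X j) :
    M.right X (T.comp h f g) =
      (i * j).negOnePow • (dgModK K).comp ((add_comm j i).trans h) (M.right X g) (M.right X f) := by
  have e1 := M.map_comp (X := (X, t)) (Y := (X, s)) (Z := (X, r)) ((add_comm j i).trans h)
    (tmul (A := U.Hom X X) (B := T.Hom r s) (zero_add j) (U.id X) g)
    (tmul (A := U.Hom X X) (B := T.Hom s t) (zero_add i) (U.id X) f)
  have e := tensorComp_tmul U T.op ((add_comm j i).trans h) (zero_add j) (zero_add i)
    (zero_add 0) ((add_comm j i).trans h) (U.id X) g (U.id X) f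
  rw [mul_zero, Int.negOnePow_zero, one_smul, U.id_comp] at e
  have e2 : T.op.comp ((add_comm j i).trans h) g f = (j * i).negOnePow • T.comp h f g := rfl
  rw [e2, map_sign] at e
  have e3 := congrArg (M.map (X := (X, t)) (Y := (X, r))) e
  have e4 := (e1.symm.trans e3).trans (map_sign (M.map (X := (X, t)) (Y := (X, r))) _ _)
  have e5 := congrArg (fun z => (i * j).negOnePow • z) e4
  simp only [smul_smul, ← Int.negOnePow_add] at e5
  rw [sign_congr (a := i * j + j * i) (b := 0) _ ⟨i * j, by ring⟩, Int.negOnePow_zero,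
    one_smul] at e5
  exact e5.symm

theorem left_right (M : DgBimod U T) {X Y : U.Obj} {s t : T.Obj} {i j n : ℤ} (h : i + j = n)
    (u : (U.Hom X Y).X i) (f : (T.Hom s t).X j) :
    (dgModK K).comp h (M.left s u) (M.right X f) = (j * i).negOnePow •
      (dgModK K).comp ((add_comm j i).trans h) (M.right Y f) (M.left t u) := by
  have e1 := M.map_comp (X := (X, t)) (Y := (X, s)) (Z := (Y, s)) h
    (tmul (A := U.Hom X Y) (B := T.Hom s s) (add_zero i) u (T.id s))
    (tmul (A := U.Hom X X) (B := T.Hom s t) (zero_add j) (U.id X) f)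
  have e2 := M.map_comp (X := (X, t)) (Y := (Y, t)) (Z := (Y, s)) ((add_comm j i).trans h)
    (tmul (A := U.Hom Y Y) (B := T.Hom s t) (zero_add j) (U.id Y) f)
    (tmul (A := U.Hom X Y) (B := T.Hom t t) (add_zero i) u (T.id t))
  have f1 := tensorComp_tmul U T.op h (add_zero i) (zero_add j) (add_zero i) (zero_add j)
    u (T.id s) (U.id X) f
  have f2 := tensorComp_tmul U T.op ((add_comm j i).trans h) (zero_add j) (add_zero i)
    (zero_add i) (add_zero j) (U.id Y) f u (T.id t)
  rw [zero_mul, Int.negOnePow_zero, one_smul, U.comp_id, T.op.id_comp f] at f1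
  rw [U.id_comp, T.op.comp_id f] at f2
  have g1 := e1.symm.trans (congrArg (M.map (X := (X, t)) (Y := (Y, s))) f1)
  have g2 := (e2.symm.trans (congrArg (M.map (X := (X, t)) (Y := (Y, s))) f2)).trans
    (map_sign (M.map (X := (X, t)) (Y := (Y, s))) _ _)
  have g3 := congrArg (fun z => (j * i).negOnePow • z) g2
  simp only [smul_smul, ← Int.negOnePow_add] at g3
  rw [sign_congr (a := j * i + j * i) (b := 0) _ ⟨i * j, by ring⟩, Int.negOnePow_zero,
    one_smul] at g3
  exact g1.trans g3.symm

theorem left_d (M : DgBimod U T) {X Y : U.Obj} (t : T.Obj) {n n' : ℤ} (h : n + 1 = n')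
    (f : (U.Hom X Y).X n) :
    M.left t (U.d n n' f) = (dgModK K).d n n' (M.left t f) := by
  refine Eq.trans ?_ (M.map_d (X := (X, t)) (Y := (Y, t)) h
    (tmul (A := U.Hom X Y) (B := T.Hom t t) (add_zero n) f (T.id t)))
  have e := tensorD_tmul (A := U.Hom X Y) (B := T.Hom t t) h h (zero_add 1) (add_zero n) f (T.id t)
  have e2 : T.d 0 1 (T.id t) = 0 := T.d_id t
  rw [e2, map_zero, smul_zero, add_zero] at e
  exact congrArg (M.map (X := (X, t)) (Y := (Y, t))) e.symm

theorem right_d (M : DgBimod U T) (X : U.Obj) {s t : T.Obj} {n n' : ℤ} (h : n + 1 = n')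
    (f : (T.Hom s t).X n) :
    M.right X (T.d n n' f) = (dgModK K).d n n' (M.right X f) := by
  refine Eq.trans ?_ (M.map_d (X := (X, t)) (Y := (X, s)) h
    (tmul (A := U.Hom X X) (B := T.Hom s t) (zero_add n) (U.id X) f))
  have e := tensorD_tmul (A := U.Hom X X) (B := T.Hom s t) h (zero_add 1) h (zero_add n) (U.id X) f
  have e2 : U.d 0 1 (U.id X) = 0 := U.d_id X
  rw [e2, map_zero, LinearMap.zero_apply, Int.negOnePow_zero, one_smul, zero_add] at e
  exact congrArg (M.map (X := (X, t)) (Y := (X, s))) e.symm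

/-- The dg `U`-module `M_t = M(-, t)`. -/
def column (M : DgBimod U T) (t : T.Obj) : (dgMod U).Obj where
  obj X := M.obj (X, t)
  map := M.left t
  map_id X := M.left_id X t
  map_comp h f g := M.left_comp t h f g
  map_d h f := M.left_d t h f

/-- The morphism `M_t → M_s` of degree `n` induced by `f : s → t` of degree `n`. -/
def columnHom (M : DgBimod U T) {s t : T.Obj} {n : ℤ} (f : (T.Hom s t).X n) :
    ((dgMod U).Hom (M.column t) (M.column s)).X n :=
  mkNat (F := M.column t) (G := M.column s) (fun X => M.right X f)
    fun {_ _} h {_ _} u => M.left_right h u f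

/-- The dg-functor `T → DgMod(U)^op`, `t ↦ M_t`. -/
def columns (M : DgBimod U T) : DgFunctor T (dgMod U).op where
  obj t := M.column t
  map {s t n} :=
    { toFun := fun f => M.columnHom f
      map_add' := fun f g => natApp_ext fun X => map_add (M.right X) f g
      map_smul' := fun c f => natApp_ext fun X => map_smul (M.right X) c f }
  map_id t := natApp_ext fun X => M.right_id X t
  map_comp {r s t i j n} h f g := natApp_ext fun X => (M.right_comp X h f g).trans
    (natApp_sign ((i * j).negOnePow)
      ((dgMod U).comp ((add_comm j i).trans h) (M.columnHom g) (M.columnHom f)) X).symm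
  map_d h f := natApp_ext fun X => M.right_d X h f

/-- The dg-functor `𝔾 : DgMod(U) → DgMod(T)` with `𝔾(B)(t) = Hom(M_t, B)`; for `f : s → t` in
`T` and `η : M_s → B`, `𝔾(B)(f)` sends `η` to `(-1)^{|f||η|} η ∘ f̄`, where `f̄ : M_t → M_s` is
given by the action of `1 ⊗ f^op`. It is the Yoneda dg-functor of `DgMod(U)` restricted along
`t ↦ M_t`. -/
def G (M : DgBimod U T) : DgFunctor (dgMod U) (dgMod T) :=
  (M.columns.precomp (dgModK K)).comp (DgFunctor.yoneda (dgMod U))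

end DgBimod
end bimodule

section triangular
variable {K : Type u} [CommRing K]

/-- `app` as a linear map. -/
def appₗ {M N : CochainComplex (ModuleCat.{w} K) ℤ} {n : ℤ} (p q : ℤ) (h : p + n = q) :
    ((dgModK K).Hom M N).X n →ₗ[K] M.X p →ₗ[K] N.X q where
  toFun f := app f p q h
  map_add' _ _ := rfl
  map_smul' _ _ := rfl

/-- `natApp` as a linear map. -/
def natAppₗ {C : DgCategory.{u, o, w} K} {D : DgCategory.{u, o', w'} K} {F G : DgFunctor C D}
    {n : ℤ} (X : C.Obj) :
    ((dgFun C D).Hom F G).X n →ₗ[K] (D.Hom (F.obj X) (G.obj X)).X n where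
  toFun η := natApp η X
  map_add' _ _ := rfl
  map_smul' _ _ := rfl

/-- The direct sum of two complexes. -/
def prodComplex (A B : CochainComplex (ModuleCat.{w} K) ℤ) :
    CochainComplex (ModuleCat.{w} K) ℤ where
  X n := ModuleCat.of K (A.X n × B.X n)
  d n n' := ModuleCat.ofHom (LinearMap.prodMap (A.d n n').hom (B.d n n').hom)
  shape n n' h := by
    rw [A.shape n n' h, B.shape n n' h]
    rfl
  d_comp_d' n n' n'' _ _ := by
    apply ModuleCat.hom_ext
    exact LinearMap.ext fun x => Prod.ext (hom_d_d A n n' n'' x.1) (hom_d_d B n n' n'' x.2)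

namespace DgBimod
variable {T U : DgCategory.{u, w, w} K}

/-- The left action `u • m = M(u ⊗ 1)(m)`. -/
def lact (M : DgBimod U T) {X Y : U.Obj} {t : T.Obj} {i j n : ℤ} (h : i + j = n) :
    (U.Hom X Y).X i →ₗ[K] (M.obj (X, t)).X j →ₗ[K] (M.obj (Y, t)).X n :=
  appₗ j n ((add_comm j i).trans h) ∘ₗ M.left t

/-- The right action `m • f = (-1)^{|m||f|} M(1 ⊗ f^op)(m)`. -/
def ract (M : DgBimod U T) {X : U.Obj} {s t : T.Obj} {i j n : ℤ} (h : i + j = n) :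
    (M.obj (X, t)).X i →ₗ[K] (T.Hom s t).X j →ₗ[K] (M.obj (X, s)).X n :=
  (i * j).negOnePow • (appₗ i n h ∘ₗ M.right X).flip

theorem lact_apply (M : DgBimod U T) {X Y : U.Obj} {t : T.Obj} {i j n : ℤ} (h : i + j = n)
    (u : (U.Hom X Y).X i) (m : (M.obj (X, t)).X j) :
    M.lact h u m = app (M.left t u) j n ((add_comm j i).trans h) m := rfl

theorem ract_apply (M : DgBimod U T) {X : U.Obj} {s t : T.Obj} {i j n : ℤ} (h : i + j = n)
    (m : (M.obj (X, t)).X i) (f : (T.Hom s t).X j) :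
    M.ract h m f = (i * j).negOnePow • app (M.right X f) i n h m := rfl

theorem lact_id (M : DgBimod U T) {X : U.Obj} {t : T.Obj} {n : ℤ} (m : (M.obj (X, t)).X n) :
    M.lact (zero_add n) (U.id X) m = m := by
  rw [lact_apply, left_id, app_id]

theorem ract_id (M : DgBimod U T) {X : U.Obj} {t : T.Obj} {n : ℤ} (m : (M.obj (X, t)).X n) :
    M.ract (add_zero n) m (T.id t) = m := by
  rw [ract_apply, right_id, app_id, mul_zero, Int.negOnePow_zero, one_smul]

theorem lact_lact (M : DgBimod U T) {X Y Z : U.Obj} {t : T.Obj} {i j k a b n : ℤ}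
    (hij : i + j = a) (hjk : j + k = b) (h : a + k = n) (h' : i + b = n)
    (u : (U.Hom Y Z).X i) (v : (U.Hom X Y).X j) (m : (M.obj (X, t)).X k) :
    M.lact h (U.comp hij u v) m = M.lact h' u (M.lact hjk v m) := by
  rw [lact_apply, lact_apply, lact_apply, left_comp,
    app_comp hij _ _ k b n (by omega) (by omega)]

theorem ract_ract (M : DgBimod U T) {X : U.Obj} {r s t : T.Obj} {i j k a b n : ℤ}
    (hij : i + j = a) (hjk : j + k = b) (h : a + k = n) (h' : i + b = n)
    (m : (M.obj (X, t)).X i) (f : (T.Hom s t).X j) (g : (T.Hom r s).X k) :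
    M.ract h (M.ract hij m f) g = M.ract h' m (T.comp hjk f g) := by
  rw [ract_apply, ract_apply, ract_apply, right_comp, map_sign, app_sign,
    app_comp _ _ _ i a n hij h, smul_smul, smul_smul, ← Int.negOnePow_add, ← Int.negOnePow_add]
  exact sign_congr _ ⟨0, by rw [← hij, ← hjk]; ring⟩

theorem lact_ract (M : DgBimod U T) {X Y : U.Obj} {s t : T.Obj} {i j k a b n : ℤ}
    (hij : i + j = a) (hjk : j + k = b) (h : a + k = n) (h' : i + b = n)
    (u : (U.Hom X Y).X i) (m : (M.obj (X, t)).X j) (f : (T.Hom s t).X k) :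
    M.ract h (M.lact hij u m) f = M.lact h' u (M.ract hjk m f) := by
  have e := congrArg (fun z => app z j n (by omega) m) (M.left_right (n := i + k) rfl u f)
  have e1 := app_comp (n := i + k) rfl (M.left s u) (M.right X f) j b n hjk (by omega) (by omega) m
  have e2 := app_comp (n := i + k) (add_comm k i) (M.right Y f) (M.left t u) j a n (by omega) h
    (by omega) m
  have e3 := (e1.symm.trans e).trans (app_sign _ _ _ _ _ _)
  rw [e2] at e3
  rw [ract_apply, ract_apply, lact_apply, lact_apply, map_sign, e3, smul_smul,
    ← Int.negOnePow_add]
  exact sign_congr _ ⟨0, by rw [← hij]; ring⟩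

theorem lact_d (M : DgBimod U T) {X Y : U.Obj} {t : T.Obj} {i j n i' j' n' : ℤ} (h : i + j = n)
    (hi : i + 1 = i') (hj : j + 1 = j') (hn : n + 1 = n')
    (u : (U.Hom X Y).X i) (m : (M.obj (X, t)).X j) :
    ((M.obj (Y, t)).d n n').hom (M.lact h u m) =
      M.lact (by omega) (U.d i i' u) m +
        i.negOnePow • M.lact (by omega) u (((M.obj (X, t)).d j j').hom m) := by
  rw [lact_apply, lact_apply, lact_apply, left_d M t hi, app_d hi _ j j' n n' hj
    ((add_comm j i).trans h) (by omega) (by omega), sub_add_cancel]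

theorem ract_d (M : DgBimod U T) {X : U.Obj} {s t : T.Obj} {i j n i' j' n' : ℤ} (h : i + j = n)
    (hi : i + 1 = i') (hj : j + 1 = j') (hn : n + 1 = n')
    (m : (M.obj (X, t)).X i) (f : (T.Hom s t).X j) :
    ((M.obj (X, s)).d n n').hom (M.ract h m f) =
      M.ract (by omega) (((M.obj (X, t)).d i i').hom m) f +
        i.negOnePow • M.ract (by omega) m (T.d j j' f) := by
  rw [ract_apply, ract_apply, ract_apply, right_d M X hj, app_d hj _ i i' n n' hi h
    (by omega) (by omega), map_sign, smul_sub, smul_sub, smul_smul, smul_smul, smul_smul,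
    ← Int.negOnePow_add, ← Int.negOnePow_add,
    sign_congr (a := i + i * j') (b := i * j) _ ⟨i, by rw [← hj]; ring⟩,
    sign_congr (a := i + i * j' + j) (b := i' * j) _ ⟨i, by rw [← hi, ← hj]; ring⟩]
  abel

/-- The composition of the triangular matrix dg-category, the matrix product of `[[g₁, 0], [m, g₂]]`
and `[[f₁, 0], [m', f₂]]`: it is `[[g₁ f₁, 0], [m • f₁ + g₂ • m', g₂ f₂]]`. -/
def triComp (M : DgBimod U T) {P Q R : T.Obj × U.Obj} {i j n : ℤ} (h : i + j = n) :
    ((T.Hom Q.1 R.1).X i × (M.obj (R.2, Q.1)).X i × (U.Hom Q.2 R.2).X i) →ₗ[K]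
      ((T.Hom P.1 Q.1).X j × (M.obj (Q.2, P.1)).X j × (U.Hom P.2 Q.2).X j) →ₗ[K]
        ((T.Hom P.1 R.1).X n × (M.obj (R.2, P.1)).X n × (U.Hom P.2 R.2).X n) :=
  LinearMap.mk₂ K
    (fun g f => (T.comp h g.1 f.1, M.ract h g.2.1 f.1 + M.lact h g.2.2 f.2.1,
      U.comp h g.2.2 f.2.2))
    (fun a b c => by
      simp only [Prod.fst_add, Prod.snd_add, map_add, LinearMap.add_apply, Prod.mk_add_mk]
      rw [add_add_add_comm])
    (fun c a b => by
      simp only [Prod.smul_fst, Prod.smul_snd, map_smul, LinearMap.smul_apply, Prod.smul_mk,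
        smul_add])
    (fun a b c => by
      simp only [Prod.fst_add, Prod.snd_add, map_add, Prod.mk_add_mk]
      rw [add_add_add_comm])
    (fun c a b => by
      simp only [Prod.smul_fst, Prod.smul_snd, map_smul, Prod.smul_mk, smul_add])

/-- The triangular matrix dg-category `Λ = [[T, 0], [M, U]]`. Its objects are the pairs `(t, X)`
of objects of `T` and `U`; the Hom-complex from `(t, X)` to `(t', X')` is
`T(t, t') ⊕ M(X', t) ⊕ U(X, X')`, whose elements are thought of as lower triangular matrices. -/
abbrev triMat (M : DgBimod U T) : DgCategory.{u, w, w} K where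
  Obj := T.Obj × U.Obj
  Hom P Q := prodComplex (T.Hom P.1 Q.1) (prodComplex (M.obj (Q.2, P.1)) (U.Hom P.2 Q.2))
  id P := (T.id P.1, 0, U.id P.2)
  comp h := M.triComp h
  id_comp f := Prod.ext (T.id_comp _) (Prod.ext
    (by
      change M.ract _ 0 _ + M.lact _ (U.id _) _ = _
      rw [map_zero, LinearMap.zero_apply, zero_add, lact_id]) (U.id_comp _))
  comp_id f := Prod.ext (T.comp_id _) (Prod.ext
    (by
      change M.ract _ _ (T.id _) + M.lact _ _ 0 = _
      rw [map_zero, add_zero, ract_id]) (U.comp_id _))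
  assoc hij hjk h h' f g e := Prod.ext (T.assoc hij hjk h h' _ _ _) (Prod.ext
    (by
      change M.ract _ (M.ract _ _ _ + M.lact _ _ _) _ + M.lact _ (U.comp _ _ _) _ =
        M.ract _ _ (T.comp _ _ _) + M.lact _ _ (M.ract _ _ _ + M.lact _ _ _)
      rw [map_add, map_add, LinearMap.add_apply, ract_ract M hij hjk h h',
        lact_ract M hij hjk h h', lact_lact M hij hjk h h', add_assoc])
    (U.assoc hij hjk h h' _ _ _))
  leibniz {P Q R i j n i' j' n'} h hi hj hn f g := Prod.ext (T.leibniz h hi hj hn _ _) (Prod.ext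
    (by
      have h1 := M.ract_d h hi hj hn f.2.1 g.1
      have h2 := M.lact_d h hi hj hn f.2.2 g.2.1
      refine (map_add (((M.obj (R.2, P.1)).d n n').hom) (M.ract h f.2.1 g.1)
        (M.lact h f.2.2 g.2.1)).trans ?_
      rw [h1, h2, add_add_add_comm, ← smul_add]
      rfl)
    (U.leibniz h hi hj hn _ _))

end DgBimod
end triangular

section coproduct
variable {K : Type u} [CommRing K] {T U : DgCategory.{u, w, w} K}

namespace DgBimod

/-- The morphism `[f_t(x)] : M_t → B`, for `x` in `A(t)`, where `P = (A, f, B)`. -/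
def hat {M : DgBimod U T} (P : CommaObj M.G) (t : T.Obj) {j : ℤ} :
    (P.left.obj t).X j →ₗ[K] ((dgMod U).Hom (M.column t) P.right).X j :=
  app (N := (dgMod U).Hom (M.column t) P.right) (natApp P.hom t) j j (add_zero j)

theorem hat_map {M : DgBimod U T} (P : CommaObj M.G) {s t : T.Obj} {i j n : ℤ} (h : j + i = n)
    (f : (T.Hom s t).X i) (x : (P.left.obj s).X j) :
    hat P t (app (P.left.map f) j n h x) =
      (i * j).negOnePow • (dgMod U).comp h (hat P s x) (M.columnHom f) := by
  have e := congrArg (fun z => app z j n h x) (natApp_nat P.hom (add_zero i) f)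
  rw [zero_mul, Int.negOnePow_zero, one_smul] at e
  have e1 := app_comp (add_zero i) ((M.G.obj P.right).map f) (natApp P.hom s) j j n
    (add_zero j) h h x
  have e2 := app_comp (zero_add i) (natApp P.hom t) (P.left.map f) j n n h (add_zero n) h x
  exact (e1.symm.trans (e.trans e2)).symm

theorem hat_d {M : DgBimod U T} (P : CommaObj M.G) (t : T.Obj) {j j' : ℤ} (hj : j + 1 = j')
    (x : (P.left.obj t).X j) :
    hat P t (((P.left.obj t).d j j').hom x) = (dgMod U).d j j' (hat P t x) := by
  have e : (dgModK K).d 0 1 (natApp P.hom t) = 0 := congrArg (fun z => natApp z t) P.closed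
  have e1 := app_d (zero_add 1) (natApp P.hom t) j j' j j' hj (add_zero j) hj (add_zero j') x
  rw [e, app_zero, Int.negOnePow_zero, one_smul] at e1
  exact (sub_eq_zero.1 e1.symm).symm

/-- The element `m · x = (-1)^{|m||x|} [f_t(x)]_X(m)` of `B(X)`. -/
def dot {M : DgBimod U T} (P : CommaObj M.G) {X : U.Obj} {t : T.Obj} {i j n : ℤ}
    (h : i + j = n) :
    (M.obj (X, t)).X i →ₗ[K] (P.left.obj t).X j →ₗ[K] (P.right.obj X).X n :=
  (i * j).negOnePow • (appₗ i n h ∘ₗ natAppₗ X ∘ₗ hat P t).flip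

theorem dot_apply {M : DgBimod U T} (P : CommaObj M.G) {X : U.Obj} {t : T.Obj} {i j n : ℤ}
    (h : i + j = n) (m : (M.obj (X, t)).X i) (x : (P.left.obj t).X j) :
    dot P h m x = (i * j).negOnePow • app (natApp (hat P t x) X) i n h m := rfl

theorem dot_ract {M : DgBimod U T} (P : CommaObj M.G) {X : U.Obj} {s t : T.Obj}
    {i j k a b n : ℤ} (hij : i + j = a) (hkj : k + j = b) (h : a + k = n) (h' : i + b = n)
    (m : (M.obj (X, t)).X i) (f : (T.Hom s t).X j) (x : (P.left.obj s).X k) :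
    dot P h (M.ract hij m f) x = dot P h' m (app (P.left.map f) k b hkj x) := by
  have e := app_comp hkj (natApp (hat P s x) X) (M.right X f) i a n hij h h' m
  have e1 : dot P h' m (app (P.left.map f) k b hkj x) =
      (i * b).negOnePow • ((j * k).negOnePow •
        app (natApp (hat P s x) X) a n h (app (M.right X f) i a hij m)) := by
    rw [dot_apply, hat_map]
    exact congrArg _ ((app_sign (M := M.obj (X, t)) (N := P.right.obj X) _ _ _ _ _ _).trans
      (congrArg _ e))
  have e2 : dot P h (M.ract hij m f) x =
      (a * k).negOnePow • ((i * j).negOnePow •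
        app (natApp (hat P s x) X) a n h (app (M.right X f) i a hij m)) := by
    rw [dot_apply]
    exact congrArg _ (map_sign (app (natApp (hat P s x) X) a n h) _ _)
  rw [e1, e2, smul_smul, smul_smul, ← Int.negOnePow_add, ← Int.negOnePow_add]
  exact sign_congr _ ⟨0, by rw [← hij, ← hkj]; ring⟩

theorem dot_lact {M : DgBimod U T} (P : CommaObj M.G) {X Y : U.Obj} {t : T.Obj}
    {i j k a b n : ℤ} (hij : i + j = a) (hjk : j + k = b) (h : a + k = n) (hb : b + i = n)
    (u : (U.Hom X Y).X i) (m : (M.obj (X, t)).X j) (x : (P.left.obj t).X k) :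
    dot P h (M.lact hij u m) x = app (P.right.map u) b n hb (dot P hjk m x) := by
  have e := congrArg (fun z => app z j n (by omega) m)
    (natApp_nat (hat P t x) (l := i + k) rfl u)
  have e1 := app_comp (n := i + k) rfl (P.right.map u) (natApp (hat P t x) X) j b n hjk hb
    (by omega) m
  have e2 := app_comp (n := i + k) (add_comm k i) (natApp (hat P t x) Y) (M.left t u) j a n
    (by omega) h (by omega) m
  have e3 := (e1.symm.trans e).trans ((app_sign _ _ _ _ _ _).trans (congrArg _ e2))
  rw [dot_apply, dot_apply, lact_apply, map_sign, e3, smul_smul, ← Int.negOnePow_add]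
  exact sign_congr _ ⟨0, by rw [← hij]; ring⟩

theorem dot_d {M : DgBimod U T} (P : CommaObj M.G) {X : U.Obj} {t : T.Obj} {i j n i' j' n' : ℤ}
    (h : i + j = n) (hi : i + 1 = i') (hj : j + 1 = j') (hn : n + 1 = n')
    (m : (M.obj (X, t)).X i) (x : (P.left.obj t).X j) :
    ((P.right.obj X).d n n').hom (dot P h m x) =
      dot P (by omega) (((M.obj (X, t)).d i i').hom m) x +
        i.negOnePow • dot P (by omega) m (((P.left.obj t).d j j').hom x) := by
  have e := app_d hj (natApp (hat P t x) X) i i' n n' hi h (by omega) (by omega) m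
  rw [dot_apply, dot_apply, dot_apply, hat_d P t hj, natApp_d, e, map_sign, smul_sub, smul_sub,
    smul_smul, smul_smul, smul_smul, ← Int.negOnePow_add, ← Int.negOnePow_add,
    sign_congr (a := i + i * j') (b := i * j) _ ⟨i, by rw [← hj]; ring⟩,
    sign_congr (a := i + i * j' + j) (b := i' * j) _ ⟨i, by rw [← hi, ← hj]; ring⟩]
  exact (add_sub_cancel _ _).symm

/-- The action `(x, y) ↦ (A(g₁)(x), m · x + B(g₂)(y))` of the matrix `[[g₁, 0], [m, g₂]]`. -/
def coprodApp {M : DgBimod U T} (P : CommaObj M.G) {Q R : T.Obj × U.Obj} {n : ℤ}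
    (g : (T.Hom Q.1 R.1).X n × (M.obj (R.2, Q.1)).X n × (U.Hom Q.2 R.2).X n) :
    ((dgModK K).Hom (prodComplex (P.left.obj Q.1) (P.right.obj Q.2))
      (prodComplex (P.left.obj R.1) (P.right.obj R.2))).X n :=
  mkHom (M := prodComplex (P.left.obj Q.1) (P.right.obj Q.2))
    (N := prodComplex (P.left.obj R.1) (P.right.obj R.2)) fun p q h =>
    LinearMap.prod (app (P.left.map g.1) p q h ∘ₗ LinearMap.fst K _ _)
      (LinearMap.coprod (dot P ((add_comm n p).trans h) g.2.1) (app (P.right.map g.2.2) p q h))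

theorem app_coprodApp {M : DgBimod U T} (P : CommaObj M.G) {Q R : T.Obj × U.Obj} {n : ℤ}
    (g : (T.Hom Q.1 R.1).X n × (M.obj (R.2, Q.1)).X n × (U.Hom Q.2 R.2).X n)
    (p q : ℤ) (h : p + n = q) (x : (P.left.obj Q.1).X p) (y : (P.right.obj Q.2).X p) :
    app (coprodApp P g) p q h ((x, y) : (P.left.obj Q.1).X p × (P.right.obj Q.2).X p) =
      ((app (P.left.map g.1) p q h x,
        dot P ((add_comm n p).trans h) g.2.1 x + app (P.right.map g.2.2) p q h y) :
        (P.left.obj R.1).X q × (P.right.obj R.2).X q) := rfl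

/-- The dg `Λ`-module `A ∐_f B` of an object `P = (A, f, B)` of the comma dg-category: its value
at `(t, X)` is `A(t) ⊕ B(X)`. -/
def coprod {M : DgBimod U T} (P : CommaObj M.G) : DgFunctor M.triMat (dgModK K) where
  obj Q := prodComplex (P.left.obj Q.1) (P.right.obj Q.2)
  map {Q R n} :=
    { toFun := fun g => coprodApp P g
      map_add' := fun g g' => app_ext fun p q h z => Prod.ext
        (congrArg (fun φ => app φ p q h z.1) (map_add P.left.map g.1 g'.1))
        (by
          change dot P _ (g.2.1 + g'.2.1) z.1 + app (P.right.map (g.2.2 + g'.2.2)) p q h z.2 =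
            (dot P _ g.2.1 z.1 + app (P.right.map g.2.2) p q h z.2) +
              (dot P _ g'.2.1 z.1 + app (P.right.map g'.2.2) p q h z.2)
          rw [map_add, map_add, LinearMap.add_apply, app_add, add_add_add_comm])
      map_smul' := fun c g => app_ext fun p q h z => Prod.ext
        (congrArg (fun φ => app φ p q h z.1) (map_smul P.left.map c g.1))
        (by
          change dot P _ (c • g.2.1) z.1 + app (P.right.map (c • g.2.2)) p q h z.2 =
            c • (dot P _ g.2.1 z.1 + app (P.right.map g.2.2) p q h z.2)
          rw [map_smul, map_smul, LinearMap.smul_apply, app_smul, smul_add]) }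
  map_id Q := app_ext fun p q h z => by
    obtain rfl : p = q := by omega
    rw [app_id]
    refine Prod.ext ?_ ?_
    · exact (congrArg (fun φ => app φ p p h z.1) (P.left.map_id Q.1)).trans (app_id p z.1 h)
    · change dot P _ 0 z.1 + app (P.right.map (U.id Q.2)) p p h z.2 = z.2
      rw [map_zero, LinearMap.zero_apply, zero_add, P.right.map_id, app_id]
  map_comp {Q R S i j n} h f g := app_ext fun p q hpq z => by
    refine Eq.trans ?_ (app_comp h (coprodApp P f) (coprodApp P g) p (p + j) q rfl (by omega)
      hpq z).symm
    refine Prod.ext ?_ ?_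
    · exact (congrArg (fun φ => app φ p q hpq z.1) (P.left.map_comp h f.1 g.1)).trans
        (app_comp h _ _ p (p + j) q rfl (by omega) hpq z.1)
    · change dot P _ (M.ract h f.2.1 g.1 + M.lact h f.2.2 g.2.1) z.1 +
          app (P.right.map (U.comp h f.2.2 g.2.2)) p q hpq z.2 =
        dot P (by omega) f.2.1 (app (P.left.map g.1) p (p + j) rfl z.1) +
          app (P.right.map f.2.2) (p + j) q (by omega)
            (dot P (add_comm j p) g.2.1 z.1 + app (P.right.map g.2.2) p (p + j) rfl z.2)
      rw [map_add, map_add, LinearMap.add_apply, P.right.map_comp h,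
        app_comp h _ _ p (p + j) q rfl (by omega) hpq,
        dot_ract P h rfl _ (by omega), dot_lact P h (add_comm j p) _ (by omega), add_assoc]
  map_d {Q R n n'} h f := app_ext fun p q hpq z => by
    refine Eq.trans ?_ (app_d h (coprodApp P f) p (p + 1) (p + n) q rfl rfl hpq (by omega) z).symm
    refine Prod.ext ?_ ?_
    · exact (congrArg (fun φ => app φ p q hpq z.1) (P.left.map_d h f.1)).trans
        (app_d h (P.left.map f.1) p (p + 1) (p + n) q rfl rfl hpq (by omega) z.1)
    · have e1 := dot_d P (i := n) (j := p) (n := p + n) (n' := q) (by omega) h rfl (by omega)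
        f.2.1 z.1
      have e2 := app_d h (P.right.map f.2.2) p (p + 1) (p + n) q rfl rfl hpq (by omega) z.2
      change dot P _ ((M.obj (R.2, Q.1)).d n n' f.2.1) z.1 +
          app (P.right.map (U.d n n' f.2.2)) p q hpq z.2 =
        ((P.right.obj R.2).d (p + n) q).hom
            (dot P (by omega) f.2.1 z.1 + app (P.right.map f.2.2) p (p + n) rfl z.2) -
          n.negOnePow • (dot P (by omega) f.2.1 (((P.left.obj Q.1).d p (p + 1)).hom z.1) +
            app (P.right.map f.2.2) (p + 1) q (by omega)
              (((P.right.obj Q.2).d p (p + 1)).hom z.2))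
      rw [map_add, e1, P.right.map_d h, e2, smul_add]
      abel

end DgBimod
end coproduct

section equivalence
variable {K : Type u} [CommRing K]

/-- `X` and `Y` are isomorphic through closed morphisms of degree zero that are inverse to each
other. -/
def DgCategory.DgIso (C : DgCategory.{u, o, w} K) (X Y : C.Obj) : Prop :=
  ∃ (f : (C.Hom X Y).X 0) (g : (C.Hom Y X).X 0), C.d 0 1 f = 0 ∧ C.d 0 1 g = 0 ∧
    C.comp (zero_add 0) g f = C.id X ∧ C.comp (zero_add 0) f g = C.id Y

variable {C : DgCategory.{u, o, w} K} {D : DgCategory.{u, o', w'} K}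

/-- Fully faithful: bijective on the Hom-complexes, in every degree. -/
def DgFunctor.FullyFaithful (F : DgFunctor C D) : Prop :=
  ∀ (X Y : C.Obj) (n : ℤ), Function.Bijective (F.map (X := X) (Y := Y) (n := n))

/-- Essentially surjective: every object of the target is isomorphic, through closed morphisms of
degree zero, to some `F(X)`. -/
def DgFunctor.EssSurj (F : DgFunctor C D) : Prop :=
  ∀ Y : D.Obj, ∃ X : C.Obj, D.DgIso (F.obj X) Y

/-- `F : C → D` is a dg-equivalence: there is a dg-functor `H : D → C` such that `HF` and `FH` are
isomorphic to the identity dg-functors by closed dg-natural transformations of degree zero. -/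
def DgFunctor.IsDgEquivalence (F : DgFunctor C D) : Prop :=
  ∃ H : DgFunctor D C, (dgFun C C).DgIso (H.comp F) (DgFunctor.id C) ∧
    (dgFun D D).DgIso (F.comp H) (DgFunctor.id D)

end equivalence

section frakF
variable {K : Type u} [CommRing K] {T U : DgCategory.{u, w, w} K}

namespace DgBimod

/-- The component `α : A → A'` of a morphism `(α, β)` of degree `n` in the comma dg-category. -/
def commaLeft {M : DgBimod U T} {P Q : CommaObj M.G} {n : ℤ}
    (γ : ((dgComma M.G).Hom P Q).X n) : ((dgMod T).Hom P.left Q.left).X n :=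
  (Subtype.val (p := fun γ => γ ∈ commaHom M.G P Q n) γ).1

/-- The component `β : B → B'` of a morphism `(α, β)` of degree `n` in the comma dg-category. -/
def commaRight {M : DgBimod U T} {P Q : CommaObj M.G} {n : ℤ}
    (γ : ((dgComma M.G).Hom P Q).X n) : ((dgMod U).Hom P.right Q.right).X n :=
  (Subtype.val (p := fun γ => γ ∈ commaHom M.G P Q n) γ).2

theorem comma_rel {M : DgBimod U T} {P Q : CommaObj M.G} {n : ℤ}
    (γ : ((dgComma M.G).Hom P Q).X n) :
    (dgMod T).comp (zero_add n) Q.hom (commaLeft γ) =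
      (dgMod T).comp (add_zero n) (M.G.map (commaRight γ)) P.hom :=
  Subtype.property (p := fun γ => γ ∈ commaHom M.G P Q n) γ

theorem hat_comma {M : DgBimod U T} {P Q : CommaObj M.G} {n : ℤ}
    (γ : ((dgComma M.G).Hom P Q).X n) (t : T.Obj) {p q : ℤ} (h : p + n = q)
    (x : (P.left.obj t).X p) :
    hat Q t (app (natApp (commaLeft γ) t) p q h x) =
      (dgMod U).comp ((add_comm n p).trans h) (commaRight γ) (hat P t x) := by
  have e := congrArg (fun z => app (natApp z t) p q h x) (comma_rel γ)
  have e1 := app_comp (zero_add n) (natApp Q.hom t) (natApp (commaLeft γ) t) p q q h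
    (add_zero q) h x
  have e2 := app_comp (add_zero n) (natApp (M.G.map (commaRight γ)) t) (natApp P.hom t) p p q
    (add_zero p) h h x
  exact e1.symm.trans (e.trans e2)

theorem dot_comma {M : DgBimod U T} {P Q : CommaObj M.G} {n : ℤ}
    (γ : ((dgComma M.G).Hom P Q).X n) {X : U.Obj} {t : T.Obj} {i p q r l : ℤ} (h : p + n = q)
    (hq : i + q = l) (hr : i + p = r) (hl : r + n = l) (m : (M.obj (X, t)).X i)
    (x : (P.left.obj t).X p) :
    dot Q hq m (app (natApp (commaLeft γ) t) p q h x) =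
      (n * i).negOnePow • app (natApp (commaRight γ) X) r l hl (dot P hr m x) := by
  have e := app_comp ((add_comm n p).trans h) (natApp (commaRight γ) X) (natApp (hat P t x) X)
    i r l hr hl hq m
  rw [dot_apply, dot_apply, hat_comma, natApp_comp, e, map_sign, smul_smul, ← Int.negOnePow_add]
  exact sign_congr _ ⟨0, by rw [← h]; ring⟩

/-- The morphism `α_T ∐ β_U : A(T) ∐ B(U) → A'(T) ∐ B'(U)` given by a morphism `(α, β)` of the
comma dg-category. -/
def frakFApp {M : DgBimod U T} {P Q : CommaObj M.G} {n : ℤ}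
    (γ : ((dgComma M.G).Hom P Q).X n) (R : T.Obj × U.Obj) :
    ((dgModK K).Hom (prodComplex (P.left.obj R.1) (P.right.obj R.2))
      (prodComplex (Q.left.obj R.1) (Q.right.obj R.2))).X n :=
  mkHom (M := prodComplex (P.left.obj R.1) (P.right.obj R.2))
    (N := prodComplex (Q.left.obj R.1) (Q.right.obj R.2)) fun p q h =>
    LinearMap.prodMap (app (natApp (commaLeft γ) R.1) p q h)
      (app (natApp (commaRight γ) R.2) p q h)

theorem frakFApp_mem {M : DgBimod U T} {P Q : CommaObj M.G} {n : ℤ}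
    (γ : ((dgComma M.G).Hom P Q).X n) :
    frakFApp γ ∈ dgNat (coprod P) (coprod Q) n := by
  intro m l hl R S g
  refine app_ext fun p q hpq z => ?_
  have e1 := app_comp hl ((coprod Q).map g) (frakFApp γ R) p (p + n) q rfl (by omega) hpq z
  have e2 := app_comp ((add_comm n m).trans hl) (frakFApp γ S) ((coprod P).map g)
    p (p + m) q rfl (by omega) hpq z
  refine e1.trans (Eq.trans ?_ (app_sign _ _ _ _ _ _).symm)
  refine Eq.trans ?_ (congrArg _ e2.symm)
  have a1 := congrArg (fun y => app y p q hpq z.1) (natApp_nat (commaLeft γ) hl g.1)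
  have a2 := app_comp hl (Q.left.map g.1) (natApp (commaLeft γ) R.1) p (p + n) q rfl (by omega)
    hpq z.1
  have a3 := app_comp ((add_comm n m).trans hl) (natApp (commaLeft γ) S.1) (P.left.map g.1)
    p (p + m) q rfl (by omega) hpq z.1
  have b1 := congrArg (fun y => app y p q hpq z.2) (natApp_nat (commaRight γ) hl g.2.2)
  have b2 := app_comp hl (Q.right.map g.2.2) (natApp (commaRight γ) R.2) p (p + n) q rfl
    (by omega) hpq z.2
  have b3 := app_comp ((add_comm n m).trans hl) (natApp (commaRight γ) S.2) (P.right.map g.2.2)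
    p (p + m) q rfl (by omega) hpq z.2
  have c := dot_comma γ (i := m) (r := p + m) (l := q) (t := R.1) (X := S.2) (p := p) rfl
    (by omega) (by omega) (by omega) g.2.1 z.1
  refine Prod.ext ?_ ?_
  · exact a2.symm.trans (a1.trans ((app_sign _ _ _ _ _ _).trans (congrArg _ a3)))
  · change dot Q _ g.2.1 (app (natApp (commaLeft γ) R.1) p (p + n) rfl z.1) +
        app (Q.right.map g.2.2) (p + n) q _ (app (natApp (commaRight γ) R.2) p (p + n) rfl z.2) =
      (n * m).negOnePow • app (natApp (commaRight γ) S.2) (p + m) q _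
        (dot P _ g.2.1 z.1 + app (P.right.map g.2.2) p (p + m) rfl z.2)
    rw [c, map_add, smul_add]
    exact congrArg _ (b2.symm.trans (b1.trans ((app_sign _ _ _ _ _ _).trans (congrArg _ b3))))

/-- The dg-functor `𝔉` from the comma dg-category `(DgMod(T), 𝔾 DgMod(U))` to `DgMod(Λ)`, which
sends `(A, f, B)` to `A ∐_f B` and `(α, β)` to the family of the `α_T ∐ β_U`. -/
def frakF (M : DgBimod U T) : DgFunctor (dgComma M.G) (dgMod M.triMat) where
  obj P := coprod P
  map {P Q n} :=
    { toFun := fun γ => mkNat (F := coprod P) (G := coprod Q) (frakFApp γ) (frakFApp_mem γ)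
      map_add' := fun _ _ => rfl
      map_smul' := fun _ _ => rfl }
  map_id P := natApp_ext fun R => app_ext fun p q h z => by
    obtain rfl : p = q := by omega
    refine Eq.trans ?_ (app_id p z h).symm
    exact Prod.ext (app_id p z.1 h) (app_id p z.2 h)
  map_comp {P Q S i j n} h γ κ := natApp_ext fun R => app_ext fun p q hpq z => by
    refine Eq.trans ?_ (app_comp h (frakFApp γ R) (frakFApp κ R) p (p + j) q rfl (by omega)
      hpq z).symm
    exact Prod.ext
      (app_comp h (natApp (commaLeft γ) R.1) (natApp (commaLeft κ) R.1) p (p + j) q rfl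
        (by omega) hpq z.1)
      (app_comp h (natApp (commaRight γ) R.2) (natApp (commaRight κ) R.2) p (p + j) q rfl
        (by omega) hpq z.2)
  map_d {P Q n n'} h γ := natApp_ext fun R => app_ext fun p q hpq z => by
    refine Eq.trans ?_ (app_d h (frakFApp γ R) p (p + 1) (p + n) q rfl rfl hpq (by omega) z).symm
    exact Prod.ext
      (app_d h (natApp (commaLeft γ) R.1) p (p + 1) (p + n) q rfl rfl hpq (by omega) z.1)
      (app_d h (natApp (commaRight γ) R.2) p (p + 1) (p + n) q rfl rfl hpq (by omega) z.2)

end DgBimod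
end frakF

end Dg

/-!
The dg-functor `𝔉` is shown to be fully faithful and essentially surjective; a dg-functor with these
two properties is a dg-equivalence (`DgFunctor.FullyFaithful.isDgEquivalence`), an inverse being
given by a choice of preimages of objects together with closed isomorphisms of degree zero.

Both properties come from the two orthogonal families of closed matrices of degree zero
`[[1, 0], [0, 0]] : (t, X) → (t, Y)` and `[[0, 0], [0, 1]] : (s, X) → (t, X)`. They compose like
identities, and for `s = t`, `X = Y` they are idempotents with sum the identity of `(t, X)`.

*Fully faithful.* A morphism `η : A ∐_f B → A' ∐_{f'} B'` is compatible with these matrices, hence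
`η` at `(t, X)` is block diagonal, with a first block that does not depend on `X` and a second one
that does not depend on `t` (`natApp_eq_blocks`). The blocks are natural by the compatibility of `η`
with `[[f, 0], [0, 0]]` and `[[0, 0], [0, f]]`, and the compatibility with `[[0, 0], [m, 0]]` is the
relation which makes them a morphism of the comma dg-category (`blocks_mem_commaHom`). The blocks
are read off at base points, which is where the nonemptiness of `T` and `U` is used.

*Essentially surjective.* Fix base points `t₀` and `X₀`. A dg `Λ`-module `C` gives the `T`-module
`A` of elements of the `C(t, X₀)` fixed by `[[1, 0], [0, 0]]`, the `U`-module `B` of elements of the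
`C(t₀, X)` fixed by `[[0, 0], [0, 1]]`, and `f : A → 𝔾(B)` with
`f_t(x)_X(m) = (-1)^{|m||x|} C([[0, 0], [m, 0]])(x)` (`commaOf`). Moving elements between
base points and arbitrary points by the matrices above identifies `A(t) ⊕ B(X)` with `C(t, X)`
(`assemble`, `disassemble`), compatibly with the action of `Λ` (`map_assemble`).
-/

/-! ### Fully faithful and essentially surjective dg-functors -/

namespace Dg

section equivalence
variable {K : Type u} [CommRing K] {C : DgCategory.{u, o, w} K} {D : DgCategory.{u, o', w'} K}

/-- The inverse of a closed isomorphism of degree zero is closed. -/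
theorem DgCategory.d_inv_eq_zero {X Y : C.Obj} {f : (C.Hom X Y).X 0} {g : (C.Hom Y X).X 0}
    (hf : C.d 0 1 f = 0) (hgf : C.comp (zero_add 0) g f = C.id X)
    (hfg : C.comp (zero_add 0) f g = C.id Y) : C.d 0 1 g = 0 := by
  have h := C.leibniz (zero_add 0) (zero_add 1) (zero_add 1) (zero_add 1) g f
  have hid : (ModuleCat.Hom.hom ((C.Hom X X).d 0 1)) (C.id X) = 0 := C.d_id X
  have hf' : (ModuleCat.Hom.hom ((C.Hom X Y).d 0 1)) f = 0 := hf
  rw [hgf, hid, hf', map_zero, smul_zero, add_zero] at h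
  have h2 := congrArg (fun z => C.comp (add_zero 1) z g) h.symm
  simp only [map_zero, LinearMap.zero_apply] at h2
  rw [C.assoc (add_zero 1) (zero_add 0) (add_zero 1) (add_zero 1), hfg, C.comp_id] at h2
  exact h2

/-- A closed dg-natural transformation of degree zero whose components are invertible is an
isomorphism of dg-functors. -/
theorem dgFun_dgIso_of_components {F G : DgFunctor C D}
    (η : ∀ X : C.Obj, (D.Hom (F.obj X) (G.obj X)).X 0)
    (θ : ∀ X : C.Obj, (D.Hom (G.obj X) (F.obj X)).X 0)
    (nat : ∀ {X Y : C.Obj} {n : ℤ} (f : (C.Hom X Y).X n),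
      D.comp (add_zero n) (G.map f) (η X) = D.comp (zero_add n) (η Y) (F.map f))
    (closed : ∀ X, D.d 0 1 (η X) = 0)
    (hθη : ∀ X, D.comp (zero_add 0) (θ X) (η X) = D.id (F.obj X))
    (hηθ : ∀ X, D.comp (zero_add 0) (η X) (θ X) = D.id (G.obj X)) :
    (dgFun C D).DgIso F G := by
  have hη : η ∈ dgNat F G 0 := by
    intro m l h X Y f
    obtain rfl : m = l := by omega
    rw [zero_mul, Int.negOnePow_zero, one_smul]
    exact nat f
  have hθ : θ ∈ dgNat G F 0 := by
    intro m l h X Y f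
    obtain rfl : m = l := by omega
    rw [zero_mul, Int.negOnePow_zero, one_smul]
    have h1 : D.comp (zero_add m) (θ Y) (D.comp (add_zero m)
          (D.comp (add_zero m) (G.map f) (η X)) (θ X)) =
        D.comp (zero_add m) (θ Y) (D.comp (add_zero m)
          (D.comp (zero_add m) (η Y) (F.map f)) (θ X)) := by rw [nat f]
    rw [D.assoc (add_zero m) (zero_add 0) (add_zero m) (add_zero m), hηθ, D.comp_id,
      D.assoc (zero_add m) (add_zero m) (add_zero m) (zero_add m),
      ← D.assoc (zero_add 0) (zero_add m) (zero_add m) (zero_add m), hθη, D.id_comp] at h1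
    exact h1.symm
  exact ⟨mkNat η hη, mkNat θ hθ, natApp_ext closed,
    natApp_ext fun X => D.d_inv_eq_zero (closed X) (hθη X) (hηθ X),
    natApp_ext hθη, natApp_ext hηθ⟩

namespace DgFunctor

/-- The inverse of the action of a fully faithful dg-functor on morphisms of degree `n`. -/
noncomputable def FullyFaithful.preimage {F : DgFunctor C D} (hF : F.FullyFaithful)
    {X Y : C.Obj} {n : ℤ} : (D.Hom (F.obj X) (F.obj Y)).X n →ₗ[K] (C.Hom X Y).X n :=
  (LinearEquiv.ofBijective F.map (hF X Y n)).symm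

theorem FullyFaithful.map_preimage {F : DgFunctor C D} (hF : F.FullyFaithful)
    {X Y : C.Obj} {n : ℤ} (g : (D.Hom (F.obj X) (F.obj Y)).X n) : F.map (hF.preimage g) = g :=
  (LinearEquiv.ofBijective F.map (hF X Y n)).apply_symm_apply g

/-- The conjugate `j' ∘ g ∘ i` of `g : Y → Y'` by `i : Z → Y` and `j' : Y' → Z'` of degree
zero. -/
def conj {Y Y' Z Z' : D.Obj} (i : (D.Hom Z Y).X 0) (j' : (D.Hom Y' Z').X 0) {n : ℤ} :
    (D.Hom Y Y').X n →ₗ[K] (D.Hom Z Z').X n :=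
  D.comp (zero_add n) j' ∘ₗ (D.comp (add_zero n)).flip i

theorem conj_apply {Y Y' Z Z' : D.Obj} (i : (D.Hom Z Y).X 0) (j' : (D.Hom Y' Z').X 0) {n : ℤ}
    (g : (D.Hom Y Y').X n) :
    conj i j' g = D.comp (zero_add n) j' (D.comp (add_zero n) g i) := rfl

theorem conj_comp {Y Y' Y'' Z Z' Z'' : D.Obj} {i : (D.Hom Z Y).X 0} {i' : (D.Hom Z' Y').X 0}
    {j' : (D.Hom Y' Z').X 0} {j'' : (D.Hom Y'' Z'').X 0}
    (hij : D.comp (zero_add 0) i' j' = D.id Y') {a b n : ℤ} (h : a + b = n)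
    (f : (D.Hom Y' Y'').X a) (g : (D.Hom Y Y').X b) :
    conj i j'' (D.comp h f g) = D.comp h (conj i' j'' f) (conj i j' g) := by
  simp only [conj_apply]
  rw [D.assoc (zero_add a) h h (zero_add n), D.assoc (add_zero a) (zero_add b) h h,
    ← D.assoc (zero_add 0) (zero_add b) (zero_add b) (zero_add b), hij, D.id_comp,
    D.assoc h (add_zero b) (add_zero n) h]

theorem comp_conj {Y Y' Z Z' : D.Obj} {i : (D.Hom Z Y).X 0} {i' : (D.Hom Z' Y').X 0}
    {j' : (D.Hom Y' Z').X 0} (hij : D.comp (zero_add 0) i' j' = D.id Y') {n : ℤ}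
    (g : (D.Hom Y Y').X n) :
    D.comp (zero_add n) i' (conj i j' g) = D.comp (add_zero n) g i := by
  rw [conj_apply, ← D.assoc (zero_add 0) (zero_add n) (zero_add n) (zero_add n), hij, D.id_comp]

theorem conj_d {Y Y' Z Z' : D.Obj} {i : (D.Hom Z Y).X 0} {j' : (D.Hom Y' Z').X 0}
    (hi : D.d 0 1 i = 0) (hj : D.d 0 1 j' = 0) {n n' : ℤ} (h : n + 1 = n')
    (g : (D.Hom Y Y').X n) : conj i j' (D.d n n' g) = D.d n n' (conj i j' g) := by
  have e1 := D.leibniz (zero_add n) (zero_add 1) h h j' (D.comp (add_zero n) g i)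
  have e2 := D.leibniz (add_zero n) h (zero_add 1) h g i
  have hi' : (ModuleCat.Hom.hom ((D.Hom Z Y).d 0 1)) i = 0 := hi
  have hj' : (ModuleCat.Hom.hom ((D.Hom Y' Z').d 0 1)) j' = 0 := hj
  rw [hi', map_zero, smul_zero, add_zero] at e2
  rw [hj', map_zero, LinearMap.zero_apply, zero_add, Int.negOnePow_zero, one_smul, e2] at e1
  exact e1.symm

/-- A fully faithful and essentially surjective dg-functor is a dg-equivalence. An inverse sends
`Y` to a chosen object `X_Y` with an isomorphism `i_Y : F(X_Y) → Y`, and `g : Y → Y'` to the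
preimage under `F` of `i_{Y'}⁻¹ ∘ g ∘ i_Y`. -/
theorem FullyFaithful.isDgEquivalence {F : DgFunctor C D} (hF : F.FullyFaithful)
    (hS : F.EssSurj) : F.IsDgEquivalence := by
  choose pre i j hi hj hji hij using hS
  have inj : ∀ {X Y : C.Obj} {n : ℤ}, Function.Injective (F.map (X := X) (Y := Y) (n := n)) :=
    fun {X Y n} => (hF X Y n).1
  let H : DgFunctor D C :=
    { obj := pre
      map := fun {Y Y' n} => hF.preimage ∘ₗ conj (i Y) (j Y')
      map_id := fun Y => inj <| by
        rw [LinearMap.comp_apply, hF.map_preimage, F.map_id, conj_apply, D.id_comp, hji]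
      map_comp := fun {Y Y' Y'' a b n} h f g => inj <| by
        rw [F.map_comp]
        simp only [LinearMap.comp_apply, hF.map_preimage]
        exact conj_comp (hij Y') h f g
      map_d := fun {Y Y' n n'} h g => inj <| by
        rw [F.map_d h]
        simp only [LinearMap.comp_apply, hF.map_preimage]
        exact conj_d (hi Y) (hj Y') h g }
  have hH : ∀ {Y Y' : D.Obj} {n : ℤ} (g : (D.Hom Y Y').X n),
      F.map (H.map g) = conj (i Y) (j Y') g := fun g => hF.map_preimage _
  refine ⟨H, ?_, ?_⟩
  · let p (X : C.Obj) : (C.Hom (pre (F.obj X)) X).X 0 := hF.preimage (i (F.obj X))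
    let q (X : C.Obj) : (C.Hom X (pre (F.obj X))).X 0 := hF.preimage (j (F.obj X))
    have hp : ∀ X, F.map (p X) = i (F.obj X) := fun X => hF.map_preimage _
    have hq : ∀ X, F.map (q X) = j (F.obj X) := fun X => hF.map_preimage _
    have nat : ∀ {X Y : C.Obj} {n : ℤ} (f : (C.Hom X Y).X n),
        C.comp (add_zero n) f (p X) = C.comp (zero_add n) (p Y) (H.map (F.map f)) := by
      intro X Y n f
      refine inj ?_
      rw [F.map_comp, F.map_comp, hp, hp, hH, comp_conj (hij _)]
    refine dgFun_dgIso_of_components (F := H.comp F) (G := DgFunctor.id C) p q nat ?_ ?_ ?_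
    · intro X
      have h : C.d 0 1 (p X) = 0 := inj <| by
        rw [F.map_d (zero_add 1), hp, map_zero]
        exact hi _
      exact h
    · intro X
      have h : C.comp (zero_add 0) (q X) (p X) = C.id (pre (F.obj X)) := inj <| by
        rw [F.map_comp, hp, hq, hji, F.map_id]
      exact h
    · intro X
      have h : C.comp (zero_add 0) (p X) (q X) = C.id X := inj <| by
        rw [F.map_comp, hp, hq, hij, F.map_id]
      exact h
  · refine dgFun_dgIso_of_components (F := F.comp H) (G := DgFunctor.id D) i j ?_ hi hji hij
    intro Y Y' n g
    change D.comp _ g _ = D.comp _ _ (F.map (H.map g))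
    rw [hH, comp_conj (hij _)]

end DgFunctor
end equivalence

end Dg

/-! ### Elements of dg-modules, and the entries of triangular matrices -/

namespace Dg

section components
variable {K : Type u} [CommRing K] {C : DgCategory.{u, o, w} K}

/-- The naturality of a morphism of dg-modules, on elements. -/
theorem natApp_app {F G : DgFunctor C (dgModK.{u, w'} K)} {n : ℤ}
    (η : ((dgFun C (dgModK K)).Hom F G).X n) {X Y : C.Obj} {m p q q' r : ℤ}
    (f : (C.Hom X Y).X m) (hpq : p + n = q) (hq : q + m = r) (hpq' : p + m = q')
    (hq' : q' + n = r) (x : (F.obj X).X p) :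
    app (G.map f) q r hq (app (natApp η X) p q hpq x) =
      (n * m).negOnePow • app (natApp η Y) q' r hq' (app (F.map f) p q' hpq' x) := by
  have h : p + (m + n) = r := by omega
  have e := congrArg (fun z => app z p r h x) (natApp_nat η rfl f)
  have e1 := app_comp rfl (G.map f) (natApp η X) p q r hpq hq h x
  have e2 := app_comp (add_comm n m) (natApp η Y) (F.map f) p q' r hpq' hq' h x
  exact e1.symm.trans (e.trans ((app_sign _ _ _ _ _ _).trans (congrArg _ e2)))

/-- Functoriality on elements. -/
theorem app_map_comp (F : DgFunctor C (dgModK.{u, w'} K)) {X Y Z : C.Obj} {i j n p q r : ℤ}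
    (h : i + j = n) (f : (C.Hom Y Z).X i) (g : (C.Hom X Y).X j) (hpq : p + j = q)
    (hqr : q + i = r) (hpr : p + n = r) (x : (F.obj X).X p) :
    app (F.map f) q r hqr (app (F.map g) p q hpq x) = app (F.map (C.comp h f g)) p r hpr x := by
  rw [F.map_comp]
  exact (app_comp h (F.map f) (F.map g) p q r hpq hqr hpr x).symm

/-- Closed morphisms of degree zero of complexes are chain maps. -/
theorem d_app_of_closed {A B : CochainComplex (ModuleCat.{w} K) ℤ}
    {f : ((dgModK K).Hom A B).X 0} (hf : (dgModK K).d 0 1 f = 0) {p p' : ℤ}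
    (h : p + 0 = p) (h' : p' + 0 = p') (x : A.X p) :
    (B.d p p').hom (app f p p h x) = app f p' p' h' ((A.d p p').hom x) := by
  by_cases hp : p + 1 = p'
  · have e := app_d (zero_add 1) f p p' p p' hp h hp h' x
    rw [hf, app_zero, Int.negOnePow_zero, one_smul] at e
    exact sub_eq_zero.1 e.symm
  · rw [B.shape p p' hp, A.shape p p' hp]
    exact (map_zero (app f p' p' h')).symm

end components

namespace DgBimod
variable {K : Type u} [CommRing K] {T U : DgCategory.{u, w, w} K}

section entries
variable (M : DgBimod U T)

/-- The matrix `[[f, 0], [0, 0]] : (s, X) → (t, Y)`. -/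
def entryT {s t : T.Obj} (X Y : U.Obj) {n : ℤ} :
    (T.Hom s t).X n →ₗ[K] (M.triMat.Hom (s, X) (t, Y)).X n :=
  LinearMap.inl K ((T.Hom s t).X n) ((M.obj (Y, s)).X n × (U.Hom X Y).X n)

/-- The matrix `[[0, 0], [m, 0]] : (s, X) → (t, Y)`. -/
def entryM {s : T.Obj} {Y : U.Obj} (X : U.Obj) (t : T.Obj) {n : ℤ} :
    (M.obj (Y, s)).X n →ₗ[K] (M.triMat.Hom (s, X) (t, Y)).X n :=
  LinearMap.inr K ((T.Hom s t).X n) ((M.obj (Y, s)).X n × (U.Hom X Y).X n) ∘ₗ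
    LinearMap.inl K ((M.obj (Y, s)).X n) ((U.Hom X Y).X n)

/-- The matrix `[[0, 0], [0, f]] : (s, X) → (t, Y)`. -/
def entryU {X Y : U.Obj} (s t : T.Obj) {n : ℤ} :
    (U.Hom X Y).X n →ₗ[K] (M.triMat.Hom (s, X) (t, Y)).X n :=
  LinearMap.inr K ((T.Hom s t).X n) ((M.obj (Y, s)).X n × (U.Hom X Y).X n) ∘ₗ
    LinearMap.inr K ((M.obj (Y, s)).X n) ((U.Hom X Y).X n)

theorem triMat_ext {P Q : T.Obj × U.Obj} {n : ℤ} {f g : (M.triMat.Hom P Q).X n}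
    (h₁ : f.1 = g.1) (h₂ : f.2.1 = g.2.1) (h₃ : f.2.2 = g.2.2) : f = g :=
  Prod.ext h₁ (Prod.ext h₂ h₃)

theorem triMat_comp_fst {P Q R : T.Obj × U.Obj} {i j n : ℤ} (h : i + j = n)
    (f : (M.triMat.Hom Q R).X i) (g : (M.triMat.Hom P Q).X j) :
    (M.triMat.comp h f g).1 = T.comp h f.1 g.1 := rfl

theorem triMat_comp_mid {P Q R : T.Obj × U.Obj} {i j n : ℤ} (h : i + j = n)
    (f : (M.triMat.Hom Q R).X i) (g : (M.triMat.Hom P Q).X j) :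
    (M.triMat.comp h f g).2.1 = M.ract h f.2.1 g.1 + M.lact h f.2.2 g.2.1 := rfl

theorem triMat_comp_snd {P Q R : T.Obj × U.Obj} {i j n : ℤ} (h : i + j = n)
    (f : (M.triMat.Hom Q R).X i) (g : (M.triMat.Hom P Q).X j) :
    (M.triMat.comp h f g).2.2 = U.comp h f.2.2 g.2.2 := rfl

variable {r s t : T.Obj} {X Y Z : U.Obj} {i j n : ℤ} (h : i + j = n)

theorem entryT_mid (f : (T.Hom s t).X n) : (M.entryT X Y f).2.1 = 0 := rfl
theorem entryT_snd (f : (T.Hom s t).X n) : (M.entryT X Y f).2.2 = 0 := rfl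
theorem entryM_fst (m : (M.obj (Y, s)).X n) : (M.entryM X t m).1 = 0 := rfl
theorem entryM_mid (m : (M.obj (Y, s)).X n) : (M.entryM X t m).2.1 = m := rfl
theorem entryM_snd (m : (M.obj (Y, s)).X n) : (M.entryM X t m).2.2 = 0 := rfl
theorem entryU_fst (f : (U.Hom X Y).X n) : (M.entryU s t f).1 = 0 := rfl
theorem entryU_mid (f : (U.Hom X Y).X n) : (M.entryU s t f).2.1 = 0 := rfl
theorem entryU_snd (f : (U.Hom X Y).X n) : (M.entryU s t f).2.2 = f := rfl

theorem comp_entryT (f : (M.triMat.Hom (s, Y) (t, Z)).X i) (g : (T.Hom r s).X j) :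
    M.triMat.comp h f (M.entryT X Y g) =
      M.entryT X Z (T.comp h f.1 g) + M.entryM X t (M.ract h f.2.1 g) := by
  refine M.triMat_ext ?_ ?_ ?_
  · refine (M.triMat_comp_fst _ _ _).trans (add_zero _).symm
  · refine (M.triMat_comp_mid _ _ _).trans ?_
    rw [entryT_mid, map_zero, add_zero]
    exact (zero_add _).symm
  · refine (M.triMat_comp_snd _ _ _).trans ?_
    rw [entryT_snd, map_zero]
    exact (zero_add _).symm

theorem entryT_comp (g : (T.Hom s t).X i) (f : (M.triMat.Hom (r, X) (s, Y)).X j) :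
    M.triMat.comp h (M.entryT Y Z g) f = M.entryT X Z (T.comp h g f.1) := by
  refine M.triMat_ext rfl ?_ ?_
  · refine (M.triMat_comp_mid _ _ _).trans ?_
    rw [entryT_mid, entryT_snd, map_zero, map_zero, LinearMap.zero_apply, LinearMap.zero_apply]
    exact zero_add _
  · refine (M.triMat_comp_snd _ _ _).trans ?_
    rw [entryT_snd, map_zero]
    rfl

theorem comp_entryU (f : (M.triMat.Hom (s, Y) (t, Z)).X i) (g : (U.Hom X Y).X j) :
    M.triMat.comp h f (M.entryU r s g) = M.entryU r t (U.comp h f.2.2 g) := by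
  refine M.triMat_ext ?_ ?_ rfl
  · refine (M.triMat_comp_fst _ _ _).trans ?_
    rw [entryU_fst, map_zero]
    rfl
  · refine (M.triMat_comp_mid _ _ _).trans ?_
    rw [entryU_fst, entryU_mid, map_zero, map_zero]
    exact zero_add _

theorem entryU_comp (g : (U.Hom Y Z).X i) (f : (M.triMat.Hom (r, X) (s, Y)).X j) :
    M.triMat.comp h (M.entryU s t g) f =
      M.entryM X t (M.lact h g f.2.1) + M.entryU r t (U.comp h g f.2.2) := by
  refine M.triMat_ext ?_ ?_ ?_
  · refine (M.triMat_comp_fst _ _ _).trans ?_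
    rw [entryU_fst, map_zero]
    exact (zero_add _).symm
  · refine (M.triMat_comp_mid _ _ _).trans ?_
    rw [entryU_mid, map_zero, LinearMap.zero_apply, zero_add]
    exact (add_zero _).symm
  · exact (M.triMat_comp_snd _ _ _).trans (zero_add _).symm

theorem entryT_comp_entryT (f : (T.Hom s t).X i) (g : (T.Hom r s).X j) :
    M.triMat.comp h (M.entryT Y Z f) (M.entryT X Y g) = M.entryT X Z (T.comp h f g) :=
  M.entryT_comp h f _

theorem entryM_comp_entryT (m : (M.obj (Z, s)).X i) (g : (T.Hom r s).X j) :
    M.triMat.comp h (M.entryM Y t m) (M.entryT X Y g) = M.entryM X t (M.ract h m g) := by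
  rw [comp_entryT, entryM_fst, entryM_mid, map_zero, LinearMap.zero_apply, map_zero, zero_add]

theorem entryU_comp_entryT (f : (U.Hom Y Z).X i) (g : (T.Hom r s).X j) :
    M.triMat.comp h (M.entryU s t f) (M.entryT X Y g) = 0 := by
  rw [comp_entryT, entryU_fst, entryU_mid, map_zero, map_zero, LinearMap.zero_apply,
    LinearMap.zero_apply, map_zero, map_zero, zero_add]

theorem entryU_comp_entryU (f : (U.Hom Y Z).X i) (g : (U.Hom X Y).X j) :
    M.triMat.comp h (M.entryU s t f) (M.entryU r s g) = M.entryU r t (U.comp h f g) :=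
  M.comp_entryU h _ g

theorem entryT_comp_entryU (f : (T.Hom s t).X i) (g : (U.Hom X Y).X j) :
    M.triMat.comp h (M.entryT Y Z f) (M.entryU r s g) = 0 := by
  rw [comp_entryU, entryT_snd, map_zero, LinearMap.zero_apply, map_zero]

theorem entryU_comp_entryM (f : (U.Hom Y Z).X i) (m : (M.obj (Y, r)).X j) :
    M.triMat.comp h (M.entryU s t f) (M.entryM X s m) = M.entryM X t (M.lact h f m) := by
  rw [entryU_comp, entryM_mid, entryM_snd, map_zero, map_zero, add_zero]

theorem triMat_id_eq (t : T.Obj) (X : U.Obj) :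
    M.triMat.id (t, X) = M.entryT X X (T.id t) + M.entryU t t (U.id X) :=
  M.triMat_ext (add_zero _).symm (add_zero _).symm (zero_add _).symm

theorem entryT_d (n n' : ℤ) (f : (T.Hom s t).X n) :
    M.triMat.d n n' (M.entryT X Y f) = M.entryT X Y (T.d n n' f) :=
  M.triMat_ext rfl (map_zero ((M.obj (Y, s)).d n n').hom) (map_zero (U.d n n'))

theorem entryM_d (n n' : ℤ) (m : (M.obj (Y, s)).X n) :
    M.triMat.d n n' (M.entryM X t m) = M.entryM X t (((M.obj (Y, s)).d n n').hom m) :=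
  M.triMat_ext (map_zero (T.d n n')) rfl (map_zero (U.d n n'))

theorem entryU_d (n n' : ℤ) (f : (U.Hom X Y).X n) :
    M.triMat.d n n' (M.entryU s t f) = M.entryU s t (U.d n n' f) :=
  M.triMat_ext (map_zero (T.d n n')) (map_zero ((M.obj (Y, s)).d n n').hom) rfl

end entries

section coprodEntries
variable {M : DgBimod U T} (P : CommaObj M.G)

/-- The inclusion of `A(t)` into `(A ∐_f B)(t, X)`. -/
def coprodInl (t : T.Obj) (X : U.Obj) {p : ℤ} :
    (P.left.obj t).X p →ₗ[K] ((coprod P).obj (t, X)).X p :=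
  LinearMap.inl K ((P.left.obj t).X p) ((P.right.obj X).X p)

/-- The inclusion of `B(X)` into `(A ∐_f B)(t, X)`. -/
def coprodInr (t : T.Obj) (X : U.Obj) {p : ℤ} :
    (P.right.obj X).X p →ₗ[K] ((coprod P).obj (t, X)).X p :=
  LinearMap.inr K ((P.left.obj t).X p) ((P.right.obj X).X p)

/-- The projection of `(A ∐_f B)(t, X)` onto `A(t)`. -/
def coprodFst (t : T.Obj) (X : U.Obj) {p : ℤ} :
    ((coprod P).obj (t, X)).X p →ₗ[K] (P.left.obj t).X p :=
  LinearMap.fst K ((P.left.obj t).X p) ((P.right.obj X).X p)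

/-- The projection of `(A ∐_f B)(t, X)` onto `B(X)`. -/
def coprodSnd (t : T.Obj) (X : U.Obj) {p : ℤ} :
    ((coprod P).obj (t, X)).X p →ₗ[K] (P.right.obj X).X p :=
  LinearMap.snd K ((P.left.obj t).X p) ((P.right.obj X).X p)

variable {P} {s t : T.Obj} {X Y : U.Obj} {n p q : ℤ}

theorem coprod_ext {z z' : ((coprod P).obj (t, X)).X p}
    (h₁ : coprodFst P t X z = coprodFst P t X z') (h₂ : coprodSnd P t X z = coprodSnd P t X z') :
    z = z' := Prod.ext h₁ h₂

theorem coprodFst_inl (x : (P.left.obj t).X p) :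
    coprodFst P t X (coprodInl P t X x) = x := rfl
theorem coprodSnd_inl (x : (P.left.obj t).X p) :
    coprodSnd P t X (coprodInl P t X x) = 0 := rfl
theorem coprodFst_inr (y : (P.right.obj X).X p) :
    coprodFst P t X (coprodInr P t X y) = 0 := rfl
theorem coprodSnd_inr (y : (P.right.obj X).X p) :
    coprodSnd P t X (coprodInr P t X y) = y := rfl

theorem coprodInl_fst_add_inr_snd (z : ((coprod P).obj (t, X)).X p) :
    coprodInl P t X (coprodFst P t X z) + coprodInr P t X (coprodSnd P t X z) = z :=
  Prod.ext (add_zero _) (zero_add _)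

theorem coprodFst_map (g : (M.triMat.Hom (s, X) (t, Y)).X n) (h : p + n = q)
    (z : ((coprod P).obj (s, X)).X p) :
    coprodFst P t Y (app ((coprod P).map g) p q h z) =
      app (P.left.map g.1) p q h (coprodFst P s X z) := rfl

theorem coprodSnd_map (g : (M.triMat.Hom (s, X) (t, Y)).X n) (h : p + n = q)
    (z : ((coprod P).obj (s, X)).X p) :
    coprodSnd P t Y (app ((coprod P).map g) p q h z) =
      dot P ((add_comm n p).trans h) g.2.1 (coprodFst P s X z) +
        app (P.right.map g.2.2) p q h (coprodSnd P s X z) := rfl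

theorem coprod_map_entryT (f : (T.Hom s t).X n) (h : p + n = q)
    (z : ((coprod P).obj (s, X)).X p) :
    app ((coprod P).map (M.entryT X Y f)) p q h z =
      coprodInl P t Y (app (P.left.map f) p q h (coprodFst P s X z)) := by
  refine coprod_ext rfl ?_
  rw [coprodSnd_map, entryT_mid, entryT_snd, map_zero, map_zero, LinearMap.zero_apply,
    coprodSnd_inl, app_zero, add_zero]

theorem coprod_map_entryM (m : (M.obj (Y, s)).X n) (h : p + n = q)
    (z : ((coprod P).obj (s, X)).X p) :
    app ((coprod P).map (M.entryM X t m)) p q h z =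
      coprodInr P t Y (dot P ((add_comm n p).trans h) m (coprodFst P s X z)) := by
  refine coprod_ext ?_ ?_
  · rw [coprodFst_map, entryM_fst, map_zero, app_zero, coprodFst_inr]
  · rw [coprodSnd_map, entryM_mid, entryM_snd, map_zero, coprodSnd_inr, app_zero, add_zero]

theorem coprod_map_entryU (f : (U.Hom X Y).X n) (h : p + n = q)
    (z : ((coprod P).obj (s, X)).X p) :
    app ((coprod P).map (M.entryU s t f)) p q h z =
      coprodInr P t Y (app (P.right.map f) p q h (coprodSnd P s X z)) := by
  refine coprod_ext ?_ ?_
  · rw [coprodFst_map, entryU_fst, map_zero, app_zero, coprodFst_inr]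
  · rw [coprodSnd_map, entryU_mid, entryU_snd, map_zero, LinearMap.zero_apply, zero_add,
      coprodSnd_inr]

end coprodEntries
end DgBimod
end Dg

/-! ### The functor `𝔉` is fully faithful -/

namespace Dg
namespace DgBimod
variable {K : Type u} [CommRing K] {T U : DgCategory.{u, w, w} K}

section fullyFaithful
variable {M : DgBimod U T} {P Q : CommaObj M.G} {n : ℤ}

theorem coprodFst_frakF (γ : ((dgComma M.G).Hom P Q).X n) (t : T.Obj) (X : U.Obj) {p q : ℤ}
    (h : p + n = q) (z : ((coprod P).obj (t, X)).X p) :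
    coprodFst Q t X (app (natApp (M.frakF.map γ) (t, X)) p q h z) =
      app (natApp (commaLeft γ) t) p q h (coprodFst P t X z) := rfl

theorem coprodSnd_frakF (γ : ((dgComma M.G).Hom P Q).X n) (t : T.Obj) (X : U.Obj) {p q : ℤ}
    (h : p + n = q) (z : ((coprod P).obj (t, X)).X p) :
    coprodSnd Q t X (app (natApp (M.frakF.map γ) (t, X)) p q h z) =
      app (natApp (commaRight γ) X) p q h (coprodSnd P t X z) := rfl

theorem frakF_map_injective [Nonempty T.Obj] [Nonempty U.Obj] :
    Function.Injective (M.frakF.map (X := P) (Y := Q) (n := n)) := by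
  intro γ κ h
  obtain ⟨t₀⟩ := ‹Nonempty T.Obj›
  obtain ⟨X₀⟩ := ‹Nonempty U.Obj›
  refine Subtype.ext (Prod.ext ?_ ?_)
  · refine natApp_ext fun t => app_ext fun p q hpq x => ?_
    have e := coprodFst_frakF γ t X₀ hpq (coprodInl P t X₀ x)
    rw [h] at e
    exact e.symm.trans (coprodFst_frakF κ t X₀ hpq (coprodInl P t X₀ x))
  · refine natApp_ext fun X => app_ext fun p q hpq y => ?_
    have e := coprodSnd_frakF γ t₀ X hpq (coprodInr P t₀ X y)
    rw [h] at e
    exact e.symm.trans (coprodSnd_frakF κ t₀ X hpq (coprodInr P t₀ X y))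

variable (η : ((dgMod M.triMat).Hom (coprod P) (coprod Q)).X n)

/-- A morphism `A ∐_f B → A' ∐_{f'} B'` is compatible with `[[1, 0], [0, 0]] : (t, X) → (t, Y)`: its
first component depends on the first component alone, and not on the object of `U`. -/
theorem coprodFst_natApp (t : T.Obj) (X Y : U.Obj) {p q : ℤ} (h : p + n = q)
    (z : ((coprod P).obj (t, X)).X p) :
    app (natApp η (t, Y)) p q h (coprodInl P t Y (coprodFst P t X z)) =
      coprodInl Q t Y (coprodFst Q t X (app (natApp η (t, X)) p q h z)) := by
  have e := natApp_app η (M.entryT X Y (T.id t)) h (add_zero q) (add_zero p) h z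
  rw [coprod_map_entryT, coprod_map_entryT, Q.left.map_id, P.left.map_id, app_id, app_id,
    mul_zero, Int.negOnePow_zero, one_smul] at e
  exact e.symm

/-- A morphism `A ∐_f B → A' ∐_{f'} B'` is compatible with `[[0, 0], [0, 1]] : (s, X) → (t, X)`: its
second component depends on the second component alone, and not on the object of `T`. -/
theorem coprodSnd_natApp (s t : T.Obj) (X : U.Obj) {p q : ℤ} (h : p + n = q)
    (z : ((coprod P).obj (s, X)).X p) :
    app (natApp η (t, X)) p q h (coprodInr P t X (coprodSnd P s X z)) =
      coprodInr Q t X (coprodSnd Q s X (app (natApp η (s, X)) p q h z)) := by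
  have e := natApp_app η (M.entryU s t (U.id X)) h (add_zero q) (add_zero p) h z
  rw [coprod_map_entryU, coprod_map_entryU, Q.right.map_id, P.right.map_id, app_id, app_id,
    mul_zero, Int.negOnePow_zero, one_smul] at e
  exact e.symm

/-- The morphism `α : A → A'` underlying a morphism `A ∐_f B → A' ∐_{f'} B'`, read off at the
object `X₀` of `U`. -/
def leftBlock (X₀ : U.Obj) (t : T.Obj) :
    ((dgModK K).Hom (P.left.obj t) (Q.left.obj t)).X n :=
  mkHom fun p q h => coprodFst Q t X₀ ∘ₗ app (natApp η (t, X₀)) p q h ∘ₗ coprodInl P t X₀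

/-- The morphism `β : B → B'` underlying a morphism `A ∐_f B → A' ∐_{f'} B'`, read off at the
object `t₀` of `T`. -/
def rightBlock (t₀ : T.Obj) (X : U.Obj) :
    ((dgModK K).Hom (P.right.obj X) (Q.right.obj X)).X n :=
  mkHom fun p q h => coprodSnd Q t₀ X ∘ₗ app (natApp η (t₀, X)) p q h ∘ₗ coprodInr P t₀ X

theorem natApp_coprodInl (X₀ : U.Obj) (t : T.Obj) (X : U.Obj) {p q : ℤ} (h : p + n = q)
    (x : (P.left.obj t).X p) :
    app (natApp η (t, X)) p q h (coprodInl P t X x) =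
      coprodInl Q t X (app (leftBlock η X₀ t) p q h x) :=
  coprodFst_natApp η t X₀ X h (coprodInl P t X₀ x)

theorem natApp_coprodInr (t₀ t : T.Obj) (X : U.Obj) {p q : ℤ} (h : p + n = q)
    (y : (P.right.obj X).X p) :
    app (natApp η (t, X)) p q h (coprodInr P t X y) =
      coprodInr Q t X (app (rightBlock η t₀ X) p q h y) :=
  coprodSnd_natApp η t₀ t X h (coprodInr P t₀ X y)

theorem leftBlock_mem (X₀ : U.Obj) : leftBlock η X₀ ∈ dgNat P.left Q.left n := by
  intro m l h s t f
  refine app_ext fun p q hpq x => ?_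
  have e := natApp_app η (M.entryT X₀ X₀ f) (p := p) (r := q) rfl (by omega) rfl (by omega)
    (coprodInl P s X₀ x)
  rw [coprod_map_entryT, coprod_map_entryT, coprodFst_inl, natApp_coprodInl η X₀,
    natApp_coprodInl η X₀, coprodFst_inl] at e
  have e' := congrArg (coprodFst Q t X₀) e
  rw [map_sign, coprodFst_inl, coprodFst_inl] at e'
  refine (app_comp h _ _ p (p + n) q rfl (by omega) hpq x).trans (e'.trans ?_)
  refine (congrArg _ ?_).trans (app_sign _ _ _ _ _ _).symm
  exact (app_comp _ _ _ p (p + m) q rfl (by omega) hpq x).symm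

theorem rightBlock_mem (t₀ : T.Obj) : rightBlock η t₀ ∈ dgNat P.right Q.right n := by
  intro m l h X Y f
  refine app_ext fun p q hpq y => ?_
  have e := natApp_app η (M.entryU t₀ t₀ f) (p := p) (r := q) rfl (by omega) rfl (by omega)
    (coprodInr P t₀ X y)
  rw [coprod_map_entryU, coprod_map_entryU, coprodSnd_inr, natApp_coprodInr η t₀,
    natApp_coprodInr η t₀, coprodSnd_inr] at e
  have e' := congrArg (coprodSnd Q t₀ Y) e
  rw [map_sign, coprodSnd_inr, coprodSnd_inr] at e'
  refine (app_comp h _ _ p (p + n) q rfl (by omega) hpq y).trans (e'.trans ?_)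
  refine (congrArg _ ?_).trans (app_sign _ _ _ _ _ _).symm
  exact (app_comp _ _ _ p (p + m) q rfl (by omega) hpq y).symm

/-- The equality `β(m · x) = (-1)^{n|m|} m · α(x)`, obtained from the naturality with respect to
`[[0, 0], [m, 0]]`. -/
theorem dot_leftBlock (t₀ : T.Obj) (X₀ : U.Obj) {t : T.Obj} {X : U.Obj} {i p q r l : ℤ}
    (h : p + n = q) (hq : i + q = l) (hr : i + p = r) (hl : r + n = l)
    (m : (M.obj (X, t)).X i) (x : (P.left.obj t).X p) :
    dot Q hq m (app (leftBlock η X₀ t) p q h x) =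
      (n * i).negOnePow • app (rightBlock η t₀ X) r l hl (dot P hr m x) := by
  have e := natApp_app η (M.entryM X₀ t₀ m) h (by omega) (by omega) hl (coprodInl P t X₀ x)
  rw [coprod_map_entryM, coprod_map_entryM, coprodFst_inl, natApp_coprodInl η X₀,
    natApp_coprodInr η t₀, coprodFst_inl] at e
  have e' := congrArg (coprodSnd Q t₀ X) e
  rw [map_sign, coprodSnd_inr, coprodSnd_inr] at e'
  exact e'

/-- The relation `f' ∘ α = 𝔾(β) ∘ f` between the two blocks, on elements. -/
theorem hat_leftBlock (t₀ : T.Obj) (X₀ : U.Obj) {t : T.Obj} {X : U.Obj} {i p q r l : ℤ}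
    (h : p + n = q) (hr : i + p = r) (hl : r + n = l) (hq : i + q = l)
    (m : (M.obj (X, t)).X i) (x : (P.left.obj t).X p) :
    app (natApp (hat Q t (app (leftBlock η X₀ t) p q h x)) X) i l hq m =
      app (rightBlock η t₀ X) r l hl (app (natApp (hat P t x) X) i r hr m) := by
  have e := dot_leftBlock η t₀ X₀ h hq hr hl m x
  rw [dot_apply, dot_apply, map_sign, smul_smul, ← Int.negOnePow_add,
    sign_congr (a := n * i + i * p) (b := i * q) _ ⟨0, by rw [← h]; ring⟩] at e
  exact smul_left_cancel _ e

theorem blocks_mem_commaHom (t₀ : T.Obj) (X₀ : U.Obj) :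
    (mkNat (F := P.left) (G := Q.left) (leftBlock η X₀) (leftBlock_mem η X₀),
      mkNat (F := P.right) (G := Q.right) (rightBlock η t₀) (rightBlock_mem η t₀)) ∈
      commaHom M.G P Q n := by
  refine natApp_ext fun t => app_ext fun p q hpq x => ?_
  have e1 := app_comp (zero_add n) (natApp Q.hom t) (leftBlock η X₀ t) p q q hpq
    (add_zero q) hpq x
  have e2 := app_comp (add_zero n) (natApp (M.G.map (mkNat (F := P.right) (G := Q.right)
    (rightBlock η t₀) (rightBlock_mem η t₀))) t) (natApp P.hom t) p p q
    (add_zero p) hpq hpq x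
  refine e1.trans (Eq.trans ?_ e2.symm)
  change hat Q t (app (leftBlock η X₀ t) p q hpq x) =
    (dgMod U).comp ((add_comm n p).trans hpq) (mkNat (F := P.right) (G := Q.right)
      (rightBlock η t₀) (rightBlock_mem η t₀)) (hat P t x)
  refine natApp_ext fun X => app_ext fun i l hil m => ?_
  have e3 := app_comp ((add_comm n p).trans hpq) (rightBlock η t₀ X) (natApp (hat P t x) X)
    i (i + p) l rfl (by omega) hil m
  refine Eq.trans ?_ e3.symm
  exact hat_leftBlock η t₀ X₀ hpq _ _ hil m x

theorem natApp_eq_blocks (t₀ : T.Obj) (X₀ : U.Obj) {t : T.Obj} {X : U.Obj} {p q : ℤ}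
    (h : p + n = q) (z : ((coprod P).obj (t, X)).X p) :
    app (natApp η (t, X)) p q h z =
      coprodInl Q t X (app (leftBlock η X₀ t) p q h (coprodFst P t X z)) +
        coprodInr Q t X (app (rightBlock η t₀ X) p q h (coprodSnd P t X z)) := by
  rw [← natApp_coprodInl η X₀, ← natApp_coprodInr η t₀, ← map_add, coprodInl_fst_add_inr_snd]

theorem frakF_map_surjective [Nonempty T.Obj] [Nonempty U.Obj] :
    Function.Surjective (M.frakF.map (X := P) (Y := Q) (n := n)) := by
  intro η
  obtain ⟨t₀⟩ := ‹Nonempty T.Obj›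
  obtain ⟨X₀⟩ := ‹Nonempty U.Obj›
  refine ⟨(⟨_, blocks_mem_commaHom η t₀ X₀⟩ : commaHom M.G P Q n), ?_⟩
  refine natApp_ext fun R => app_ext fun p q hpq z => ?_
  obtain ⟨t, X⟩ := R
  refine Eq.trans ?_ (natApp_eq_blocks η t₀ X₀ hpq z).symm
  exact (coprodInl_fst_add_inr_snd (P := Q) _).symm

theorem frakF_fullyFaithful [Nonempty T.Obj] [Nonempty U.Obj] (M : DgBimod U T) :
    M.frakF.FullyFaithful :=
  fun _ _ _ => ⟨frakF_map_injective, frakF_map_surjective⟩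

end fullyFaithful
end DgBimod
end Dg

/-! ### Corners of a dg module over the triangular matrix dg-category -/

namespace Dg

section nonunital
variable {K : Type u} [CommRing K]

/-- The data and the laws of a dg-functor, without the preservation of units. -/
structure NonunitalDgFunctor (C : DgCategory.{u, o, w} K) (D : DgCategory.{u, o', w'} K) where
  obj : C.Obj → D.Obj
  map {X Y : C.Obj} {n : ℤ} : (C.Hom X Y).X n →ₗ[K] (D.Hom (obj X) (obj Y)).X n
  map_comp {X Y Z : C.Obj} {i j n : ℤ} (h : i + j = n)
    (f : (C.Hom Y Z).X i) (g : (C.Hom X Y).X j) :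
    map (C.comp h f g) = D.comp h (map f) (map g)
  map_d {X Y : C.Obj} {n n' : ℤ} (h : n + 1 = n') (f : (C.Hom X Y).X n) :
    map (C.d n n' f) = D.d n n' (map f)

namespace NonunitalDgFunctor
variable {C : DgCategory.{u, o, w} K} (E : NonunitalDgFunctor C (dgModK.{u, w'} K))

theorem app_map_comp {X Y Z : C.Obj} {i j n p q r : ℤ}
    (h : i + j = n) (f : (C.Hom Y Z).X i) (g : (C.Hom X Y).X j) (hpq : p + j = q)
    (hqr : q + i = r) (hpr : p + n = r) (x : (E.obj X).X p) :
    app (E.map f) q r hqr (app (E.map g) p q hpq x) = app (E.map (C.comp h f g)) p r hpr x := by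
  rw [E.map_comp]
  exact (app_comp h (E.map f) (E.map g) p q r hpq hqr hpr x).symm

theorem d_map_id (X : C.Obj) : (dgModK K).d 0 1 (E.map (C.id X)) = 0 := by
  have h : C.d 0 1 (C.id X) = 0 := C.d_id X
  rw [← E.map_d (zero_add 1), h, map_zero]

/-- The elements of `E(X)` of degree `n` that are fixed by the idempotent `E(1_X)`. -/
def fixed (X : C.Obj) (n : ℤ) : Submodule K ((E.obj X).X n) :=
  LinearMap.eqLocus (app (E.map (C.id X)) n n (add_zero n)) LinearMap.id

theorem map_mem_fixed {X Y : C.Obj} {n p q : ℤ} (f : (C.Hom X Y).X n) (h : p + n = q)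
    (x : (E.obj X).X p) : app (E.map f) p q h x ∈ E.fixed Y q := by
  refine (E.app_map_comp (zero_add n) (C.id Y) f h (add_zero q) h x).trans ?_
  rw [C.id_comp]
  rfl

theorem d_mem_fixed {X : C.Obj} (n n' : ℤ) (x : (E.obj X).X n) (hx : x ∈ E.fixed X n) :
    ((E.obj X).d n n').hom x ∈ E.fixed X n' := by
  refine (d_app_of_closed (E.d_map_id X) (add_zero n) (add_zero n') x).symm.trans ?_
  exact congrArg ((E.obj X).d n n').hom hx

/-- The subcomplex of `E(X)` fixed by the idempotent `E(1_X)`. -/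
def fixedComplex (X : C.Obj) : CochainComplex (ModuleCat.{w'} K) ℤ where
  X n := ModuleCat.of K (E.fixed X n)
  d n n' := ModuleCat.ofHom (LinearMap.restrict ((E.obj X).d n n').hom (E.d_mem_fixed n n'))
  shape n n' h := by
    apply ModuleCat.hom_ext
    refine LinearMap.ext fun x => Subtype.ext ?_
    have h0 : (E.obj X).d n n' = 0 := (E.obj X).shape n n' h
    exact congrArg (fun φ => ModuleCat.Hom.hom φ (x : (E.obj X).X n)) h0
  d_comp_d' n n' n'' _ _ := by
    apply ModuleCat.hom_ext
    exact LinearMap.ext fun x => Subtype.ext (hom_d_d (E.obj X) n n' n'' x.1)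

/-- The inclusion of the fixed subcomplex. -/
def incl (X : C.Obj) {n : ℤ} : (E.fixedComplex X).X n →ₗ[K] (E.obj X).X n :=
  (E.fixed X n).subtype

/-- The projection onto the fixed subcomplex given by the idempotent `E(1_X)`. -/
def proj (X : C.Obj) {n : ℤ} : (E.obj X).X n →ₗ[K] (E.fixedComplex X).X n :=
  LinearMap.codRestrict (E.fixed X n) (app (E.map (C.id X)) n n (add_zero n))
    fun x => E.map_mem_fixed (C.id X) (add_zero n) x

theorem incl_injective (X : C.Obj) {n : ℤ} : Function.Injective (E.incl X (n := n)) :=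
  Subtype.val_injective

theorem map_id_incl (X : C.Obj) {n : ℤ} (h : n + 0 = n) (x : (E.fixedComplex X).X n) :
    app (E.map (C.id X)) n n h (E.incl X x) = E.incl X x :=
  Subtype.property (p := fun x => x ∈ E.fixed X n) x

/-- The action of `f` on the fixed subcomplexes. -/
def fixedMap {X Y : C.Obj} {n : ℤ} (f : (C.Hom X Y).X n) :
    ((dgModK.{u, w'} K).Hom (E.fixedComplex X) (E.fixedComplex Y)).X n :=
  mkHom fun p q h => LinearMap.codRestrict (E.fixed Y q) (app (E.map f) p q h ∘ₗ E.incl X)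
    fun x => E.map_mem_fixed f h (E.incl X x)

/-- The dg-functor of the images of the idempotents `E(1_X)`. -/
def unital : DgFunctor C (dgModK.{u, w'} K) where
  obj X := E.fixedComplex X
  map {X Y n} :=
    { toFun := fun f => E.fixedMap f
      map_add' := fun f g => app_ext fun p q h x => E.incl_injective Y
        (congrArg (fun φ => app φ p q h (E.incl X x)) (map_add E.map f g))
      map_smul' := fun c f => app_ext fun p q h x => E.incl_injective Y
        (congrArg (fun φ => app φ p q h (E.incl X x)) (map_smul E.map c f)) }
  map_id X := app_ext fun p q h x => by
    obtain rfl : p = q := by omega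
    refine Eq.trans ?_ (app_id p x h).symm
    exact E.incl_injective X (E.map_id_incl X h x)
  map_comp {X Y Z i j n} h f g := app_ext fun p q hpq x => by
    refine Eq.trans ?_ (app_comp h (E.fixedMap f) (E.fixedMap g) p (p + j) q rfl (by omega)
      hpq x).symm
    refine E.incl_injective Z ?_
    exact (E.app_map_comp h f g rfl (by omega) hpq (E.incl X x)).symm
  map_d {X Y n n'} h f := app_ext fun p q hpq x => by
    refine Eq.trans ?_ (app_d h (E.fixedMap f) p (p + 1) (p + n) q rfl rfl hpq (by omega) x).symm
    refine E.incl_injective Y ?_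
    rw [map_sub, map_sign]
    exact (congrArg (fun φ => app φ p q hpq (E.incl X x)) (E.map_d h f)).trans
      (app_d h (E.map f) p (p + 1) (p + n) q rfl rfl hpq (by omega) (E.incl X x))

end NonunitalDgFunctor
end nonunital

namespace DgBimod
variable {K : Type u} [CommRing K] {T U : DgCategory.{u, w, w} K} {M : DgBimod U T}
  (C : DgFunctor M.triMat (dgModK.{u, w} K))

/-- The action of the matrices `[[f, 0], [0, 0]]` on the values of a dg `Λ`-module at the pairs
`(t, X₀)`. -/
def actT (X₀ : U.Obj) : NonunitalDgFunctor T (dgModK.{u, w} K) where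
  obj t := C.obj (t, X₀)
  map := C.map ∘ₗ M.entryT X₀ X₀
  map_comp h f g := by
    simp only [LinearMap.comp_apply]
    rw [← M.entryT_comp_entryT, C.map_comp]
  map_d h f := by
    simp only [LinearMap.comp_apply]
    rw [← M.entryT_d, C.map_d h]

/-- The action of the matrices `[[0, 0], [0, f]]` on the values of a dg `Λ`-module at the pairs
`(t₀, X)`. -/
def actU (t₀ : T.Obj) : NonunitalDgFunctor U (dgModK.{u, w} K) where
  obj X := C.obj (t₀, X)
  map := C.map ∘ₗ M.entryU t₀ t₀
  map_comp h f g := by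
    simp only [LinearMap.comp_apply]
    rw [← M.entryU_comp_entryU, C.map_comp]
  map_d h f := by
    simp only [LinearMap.comp_apply]
    rw [← M.entryU_d, C.map_d h]

/-- The dg `T`-module of the elements of `C(t, X₀)` fixed by `[[1, 0], [0, 0]]`. -/
def cornerT (X₀ : U.Obj) : (dgMod T).Obj := (actT C X₀).unital

/-- The dg `U`-module of the elements of `C(t₀, X)` fixed by `[[0, 0], [0, 1]]`. -/
def cornerU (t₀ : T.Obj) : (dgMod U).Obj := (actU C t₀).unital

/-- The inclusion of the corner at `t` into `C(t, X₀)`. -/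
def inclT (X₀ : U.Obj) (t : T.Obj) {n : ℤ} :
    ((cornerT C X₀).obj t).X n →ₗ[K] (C.obj (t, X₀)).X n := (actT C X₀).incl t

/-- The inclusion of the corner at `X` into `C(t₀, X)`. -/
def inclU (t₀ : T.Obj) (X : U.Obj) {n : ℤ} :
    ((cornerU C t₀).obj X).X n →ₗ[K] (C.obj (t₀, X)).X n := (actU C t₀).incl X

/-- The projection of `C(t, X₀)` onto the corner at `t`. -/
def projT (X₀ : U.Obj) (t : T.Obj) {n : ℤ} :
    (C.obj (t, X₀)).X n →ₗ[K] ((cornerT C X₀).obj t).X n := (actT C X₀).proj t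

/-- The projection of `C(t₀, X)` onto the corner at `X`. -/
def projU (t₀ : T.Obj) (X : U.Obj) {n : ℤ} :
    (C.obj (t₀, X)).X n →ₗ[K] ((cornerU C t₀).obj X).X n := (actU C t₀).proj X

variable {C} {X₀ X Y : U.Obj} {t₀ s t : T.Obj} {n p q : ℤ}

theorem inclT_injective : Function.Injective (inclT C X₀ t (n := n)) :=
  (actT C X₀).incl_injective t

theorem inclU_injective : Function.Injective (inclU C t₀ X (n := n)) :=
  (actU C t₀).incl_injective X

theorem inclT_projT (h : n + 0 = n) (z : (C.obj (t, X₀)).X n) :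
    inclT C X₀ t (projT C X₀ t z) = app (C.map (M.entryT X₀ X₀ (T.id t))) n n h z := rfl

theorem inclU_projU (h : n + 0 = n) (z : (C.obj (t₀, X)).X n) :
    inclU C t₀ X (projU C t₀ X z) = app (C.map (M.entryU t₀ t₀ (U.id X))) n n h z := rfl

theorem app_entryT_id_inclT (h : n + 0 = n) (x : ((cornerT C X₀).obj t).X n) :
    app (C.map (M.entryT X₀ X₀ (T.id t))) n n h (inclT C X₀ t x) = inclT C X₀ t x :=
  (actT C X₀).map_id_incl t h x

theorem app_entryU_id_inclU (h : n + 0 = n) (y : ((cornerU C t₀).obj X).X n) :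
    app (C.map (M.entryU t₀ t₀ (U.id X))) n n h (inclU C t₀ X y) = inclU C t₀ X y :=
  (actU C t₀).map_id_incl X h y

theorem inclT_map (f : (T.Hom s t).X n) (h : p + n = q) (x : ((cornerT C X₀).obj s).X p) :
    inclT C X₀ t (app ((cornerT C X₀).map f) p q h x) =
      app (C.map (M.entryT X₀ X₀ f)) p q h (inclT C X₀ s x) := rfl

theorem inclU_map (f : (U.Hom X Y).X n) (h : p + n = q) (y : ((cornerU C t₀).obj X).X p) :
    inclU C t₀ Y (app ((cornerU C t₀).map f) p q h y) =
      app (C.map (M.entryU t₀ t₀ f)) p q h (inclU C t₀ X y) := rfl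

theorem inclT_d (x : ((cornerT C X₀).obj t).X p) :
    inclT C X₀ t ((((cornerT C X₀).obj t).d p q).hom x) =
      ((C.obj (t, X₀)).d p q).hom (inclT C X₀ t x) := rfl

theorem inclU_d (y : ((cornerU C t₀).obj X).X p) :
    inclU C t₀ X ((((cornerU C t₀).obj X).d p q).hom y) =
      ((C.obj (t₀, X)).d p q).hom (inclU C t₀ X y) := rfl

end DgBimod
end Dg

/-! ### The comma object of a dg module over the triangular matrix dg-category -/

namespace Dg
namespace DgBimod
variable {K : Type u} [CommRing K] {T U : DgCategory.{u, w, w} K} {M : DgBimod U T}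

section columnApp
variable {B : (dgMod U).Obj} {t : T.Obj} {q : ℤ}

/-- The value of a morphism `M_t → B` at an element of `M(X, t)`. -/
def columnApp (X : U.Obj) {i n : ℤ} (h : i + q = n) :
    ((dgMod U).Hom (M.column t) B).X q →ₗ[K] (M.obj (X, t)).X i →ₗ[K] (B.obj X).X n :=
  appₗ i n h ∘ₗ natAppₗ X

theorem columnApp_ext {η θ : ((dgMod U).Hom (M.column t) B).X q}
    (H : ∀ (X : U.Obj) (i n : ℤ) (h : i + q = n) (m : (M.obj (X, t)).X i),
      columnApp X h η m = columnApp X h θ m) : η = θ :=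
  natApp_ext fun X => app_ext fun i n h m => H X i n h m

theorem columnApp_comp_columnHom {s : T.Obj} {X : U.Obj} {m r i a n : ℤ}
    (η : ((dgMod U).Hom (M.column s) B).X q) (f : (T.Hom s t).X m) (hr : q + m = r)
    (hn : i + r = n) (ha : i + m = a) (haq : a + q = n) (z : (M.obj (X, t)).X i) :
    columnApp X hn ((dgMod U).comp hr η (M.columnHom f)) z =
      columnApp X haq η (app (M.right X f) i a ha z) :=
  app_comp hr (natApp η X) (M.right X f) i a n ha haq hn z

theorem columnApp_d {X : U.Obj} {q' i i' n n' : ℤ} (hq : q + 1 = q') (hi : i + 1 = i')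
    (hn : i + q = n) (hn' : i + q' = n') (hi' : i' + q = n')
    (η : ((dgMod U).Hom (M.column t) B).X q) (z : (M.obj (X, t)).X i) :
    columnApp X hn' ((dgMod U).d q q' η) z = ((B.obj X).d n n').hom (columnApp X hn η z) -
      q.negOnePow • columnApp X hi' η (((M.obj (X, t)).d i i').hom z) :=
  app_d hq (natApp η X) i i' n n' hi hn hn' hi' z

end columnApp

section lower
variable (C : DgFunctor M.triMat (dgModK.{u, w} K)) (t₀ : T.Obj) (X₀ : U.Obj)

/-- The map `m ↦ (-1)^{|m||x|} C([[0, 0], [m, 0]])(x)` from `M(X, t)` to `B(X)`, for `x` in `A(t)`,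
where `A` and `B` are the corners of `C`. It has the degree of `x`; that degree appears as `p` and
as `q`, so that the map fits into a morphism of complexes of degree zero. -/
def lowerApp {t : T.Obj} (X : U.Obj) {p q : ℤ} (h : p + 0 = q)
    (x : ((cornerT C X₀).obj t).X p) :
    ((dgModK.{u, w} K).Hom (M.obj (X, t)) ((cornerU C t₀).obj X)).X q :=
  mkHom fun i n hi => (i * p).negOnePow • (projU C t₀ X ∘ₗ
    (appₗ p n (by omega)).flip (inclT C X₀ t x) ∘ₗ C.map ∘ₗ M.entryM X₀ t₀)

variable {C t₀ X₀}

theorem inclU_lowerApp {t : T.Obj} {X : U.Obj} {p q i n : ℤ} (h : p + 0 = q) (hi : i + q = n)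
    (hp : p + i = n) (m : (M.obj (X, t)).X i) (x : ((cornerT C X₀).obj t).X p) :
    inclU C t₀ X (app (lowerApp C t₀ X₀ X h x) i n hi m) =
      (i * p).negOnePow • app (C.map (M.entryM X₀ t₀ m)) p n hp (inclT C X₀ t x) := by
  have e : app (lowerApp C t₀ X₀ X h x) i n hi m = (i * p).negOnePow • projU C t₀ X
      (app (C.map (M.entryM X₀ t₀ m)) p n hp (inclT C X₀ t x)) := rfl
  rw [e, map_sign, inclU_projU (add_zero n), app_map_comp C (zero_add i) _ _ hp (add_zero n) hp,
    entryU_comp_entryM, lact_id]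

/-- The naturality of `lowerApp` in the object of `U`, on elements. -/
theorem map_lowerApp {t : T.Obj} {X Y : U.Obj} {p q i j a b n : ℤ} (h : p + 0 = q)
    (f : (U.Hom X Y).X j) (m : (M.obj (X, t)).X i) (x : ((cornerT C X₀).obj t).X p)
    (ha : i + q = a) (haj : a + j = n) (hb : i + j = b) (hbq : b + q = n) :
    app ((cornerU C t₀).map f) a n haj (app (lowerApp C t₀ X₀ X h x) i a ha m) =
      (q * j).negOnePow • app (lowerApp C t₀ X₀ Y h x) b n hbq (app (M.left t f) i b hb m) := by
  refine inclU_injective ?_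
  rw [inclU_map, map_sign, inclU_lowerApp h ha (by omega), inclU_lowerApp h hbq (by omega),
    map_sign, app_map_comp C ((add_comm j i).trans hb) _ _ (by omega) haj (by omega),
    entryU_comp_entryM, lact_apply, smul_smul, ← Int.negOnePow_add]
  exact sign_congr _ ⟨-(j * p), by rw [← h, ← hb]; ring⟩

/-- The map `m ↦ (-1)^{|m||x|} C([[0, 0], [m, 0]])(x)` as a morphism `M_t → B` of dg `U`-modules. -/
def lowerNat {t : T.Obj} {p q : ℤ} (h : p + 0 = q) (x : ((cornerT C X₀).obj t).X p) :
    ((dgMod U).Hom (M.column t) (cornerU C t₀)).X q :=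
  mkNat (F := M.column t) (G := cornerU C t₀) (fun X => lowerApp C t₀ X₀ X h x) <| by
    intro j l hl X Y f
    refine app_ext fun i n hi m => ?_
    refine (app_comp hl ((cornerU C t₀).map f) (lowerApp C t₀ X₀ X h x) i (i + q) n rfl
      (by omega) hi m).trans (Eq.trans ?_ (app_sign _ _ _ _ _ _).symm)
    refine (map_lowerApp h f m x rfl _ rfl (by omega)).trans (congrArg _ ?_)
    exact (app_comp ((add_comm q j).trans hl) (lowerApp C t₀ X₀ Y h x) (M.left t f) i (i + j) n
      rfl (by omega) hi m).symm

theorem lowerNat_apply {t : T.Obj} {X : U.Obj} {p q i n : ℤ} (h : p + 0 = q) (hi : i + q = n)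
    (hp : p + i = n) (m : (M.obj (X, t)).X i) (x : ((cornerT C X₀).obj t).X p) :
    inclU C t₀ X (columnApp X hi (lowerNat (t₀ := t₀) h x) m) =
      (i * p).negOnePow • app (C.map (M.entryM X₀ t₀ m)) p n hp (inclT C X₀ t x) :=
  inclU_lowerApp h hi hp m x

theorem lowerNat_ext {t : T.Obj} {q : ℤ} {η θ : ((dgMod U).Hom (M.column t) (cornerU C t₀)).X q}
    (H : ∀ (X : U.Obj) (i n : ℤ) (h : i + q = n) (m : (M.obj (X, t)).X i),
      inclU C t₀ X (columnApp X h η m) = inclU C t₀ X (columnApp X h θ m)) :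
    η = θ :=
  columnApp_ext fun X i n h m => inclU_injective (H X i n h m)

variable (C t₀ X₀)

/-- The map `A(t) → 𝔾(B)(t)` given by the lower left entries of `Λ`. -/
def lowerHom (t : T.Obj) :
    ((dgModK.{u, w} K).Hom ((cornerT C X₀).obj t) ((M.G.obj (cornerU C t₀)).obj t)).X 0 :=
  mkHom (N := (dgMod U).Hom (M.column t) (cornerU C t₀)) fun p q h =>
    { toFun := fun x => lowerNat h x
      map_add' := fun x y => lowerNat_ext fun X i n hi m => by
        have hp : p + i = n := by omega
        rw [map_add, LinearMap.add_apply, map_add, lowerNat_apply h hi hp,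
          lowerNat_apply h hi hp, lowerNat_apply h hi hp, map_add, map_add, smul_add]
      map_smul' := fun c x => lowerNat_ext fun X i n hi m => by
        have hp : p + i = n := by omega
        rw [RingHom.id_apply, map_smul, LinearMap.smul_apply, map_smul, lowerNat_apply h hi hp,
          lowerNat_apply h hi hp, map_smul, map_smul, smul_comm] }

/-- The naturality of `lowerNat` in the object of `T`. -/
theorem lowerNat_map {s t : T.Obj} {p q r m r' : ℤ} (h : p + 0 = q) (f : (T.Hom s t).X m)
    (x : ((cornerT C X₀).obj s).X p) (hq : q + m = r) (hp : p + m = r') (hr : r' + 0 = r) :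
    (m * q).negOnePow • (dgMod U).comp hq (lowerNat (t₀ := t₀) h x) (M.columnHom f) =
      lowerNat (t₀ := t₀) hr (app ((cornerT C X₀).map f) p r' hp x) := by
  refine lowerNat_ext fun X i n hi a => ?_
  rw [lowerNat_apply hr hi (by omega), inclT_map, app_map_comp C rfl _ _ hp (by omega) (by omega),
    entryM_comp_entryT, ract_apply, map_sign₂, map_sign,
    columnApp_comp_columnHom _ f hq hi rfl (by omega), lowerNat_apply h _ (by omega), map_sign,
    map_sign, app_sign, smul_smul, smul_smul, ← Int.negOnePow_add, ← Int.negOnePow_add]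
  exact sign_congr _ ⟨m * p - i * m, by rw [← h, ← hp]; ring⟩

theorem d_lowerNat {t : T.Obj} {p p' q q' : ℤ} (h : p + 0 = q) (h' : p' + 0 = q')
    (hp : p + 1 = p') (hq : q + 1 = q') (x : ((cornerT C X₀).obj t).X p) :
    (dgMod U).d q q' (lowerNat (t₀ := t₀) h x) =
      lowerNat (t₀ := t₀) h' ((((cornerT C X₀).obj t).d p p').hom x) := by
  refine lowerNat_ext fun X i n hi m => ?_
  have e := app_d (n' := i + 1) rfl (C.map (M.entryM X₀ t₀ m)) p p' (p + i) n hp rfl (by omega)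
    (by omega) (inclT C X₀ t x)
  rw [← C.map_d rfl, entryM_d] at e
  rw [columnApp_d hq rfl (show i + q = p + i by omega) hi (by omega), map_sub, map_sign, inclU_d,
    lowerNat_apply h _ (by omega), lowerNat_apply h _ (by omega), lowerNat_apply h' hi (by omega),
    inclT_d, e, map_sign, smul_sub, smul_sub, smul_smul, smul_smul, smul_smul,
    ← Int.negOnePow_add, ← Int.negOnePow_add,
    sign_congr (a := q + (i + 1) * p) (b := i * p) _ ⟨p, by rw [← h]; ring⟩,
    sign_congr (a := q + (i + 1) * p + i) (b := i * p') _ ⟨p, by rw [← h, ← hp]; ring⟩]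
  exact sub_sub_cancel _ _

/-- The closed morphism `f : A → 𝔾(B)` attached to `C`. -/
def lower : ((dgMod T).Hom (cornerT C X₀) (M.G.obj (cornerU C t₀))).X 0 :=
  mkNat (F := cornerT C X₀) (G := M.G.obj (cornerU C t₀)) (fun t => lowerHom C t₀ X₀ t) <| by
    intro m l hl s t f
    refine app_ext fun p r hr x => ?_
    rw [zero_mul, Int.negOnePow_zero, one_smul]
    refine (app_comp hl ((M.G.obj (cornerU C t₀)).map f) (lowerHom C t₀ X₀ s) p p r (add_zero p)
      (by omega) hr x).trans (Eq.trans ?_ (app_comp _ (lowerHom C t₀ X₀ t)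
        ((cornerT C X₀).map f) p r r (by omega) (add_zero r) hr x).symm)
    exact lowerNat_map C t₀ X₀ (add_zero p) f x _ _ (add_zero r)

theorem d_lower : (dgMod T).d 0 1 (lower C t₀ X₀) = 0 := by
  refine natApp_ext fun t => app_ext fun p q h x => ?_
  have e := app_d (zero_add 1) (lowerHom C t₀ X₀ t) p q p q h (add_zero p) h (add_zero q) x
  refine e.trans ?_
  rw [Int.negOnePow_zero, one_smul]
  exact sub_eq_zero.2 (d_lowerNat C t₀ X₀ (add_zero p) (add_zero q) h h x)

/-- The object `(A, f, B)` of the comma dg-category attached to a dg `Λ`-module. -/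
abbrev commaOf : CommaObj M.G where
  left := cornerT C X₀
  right := cornerU C t₀
  hom := lower C t₀ X₀
  closed := d_lower C t₀ X₀

/-- The action `m · x` of the comma object attached to `C` is the action of `[[0, 0], [m, 0]]`. -/
theorem inclU_dot_commaOf {t : T.Obj} {X : U.Obj} {i p n : ℤ} (h : i + p = n) (h' : p + i = n)
    (m : (M.obj (X, t)).X i) (x : ((cornerT C X₀).obj t).X p) :
    inclU C t₀ X (dot (commaOf C t₀ X₀) h m x) =
      app (C.map (M.entryM X₀ t₀ m)) p n h' (inclT C X₀ t x) := by
  have e : dot (commaOf C t₀ X₀) h m x =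
      (i * p).negOnePow • columnApp X h (lowerNat (t₀ := t₀) (add_zero p) x) m := rfl
  rw [e, map_sign, lowerNat_apply _ h h', smul_smul, ← Int.negOnePow_add,
    sign_congr (a := i * p + i * p) (b := 0) _ ⟨i * p, by ring⟩, Int.negOnePow_zero, one_smul]

end lower
end DgBimod
end Dg

/-! ### The functor `𝔉` is essentially surjective -/

namespace Dg
namespace DgBimod
variable {K : Type u} [CommRing K] {T U : DgCategory.{u, w, w} K} {M : DgBimod U T}

section essSurj
variable (C : DgFunctor M.triMat (dgModK.{u, w} K)) (t₀ : T.Obj) (X₀ : U.Obj)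

/-- The comparison `A(t) ⊕ B(X) → C(t, X)`, which moves the corners from the base points `X₀` and
`t₀` to `X` and `t` by means of the matrices `[[1, 0], [0, 0]]` and `[[0, 0], [0, 1]]`. -/
def assemble (t : T.Obj) (X : U.Obj) :
    ((dgModK.{u, w} K).Hom ((coprod (commaOf C t₀ X₀)).obj (t, X)) (C.obj (t, X))).X 0 :=
  mkHom fun p q h =>
    app (C.map (M.entryT X₀ X (T.id t))) p q h ∘ₗ inclT C X₀ t ∘ₗ
        coprodFst (commaOf C t₀ X₀) t X +
      app (C.map (M.entryU t₀ t (U.id X))) p q h ∘ₗ inclU C t₀ X ∘ₗ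
        coprodSnd (commaOf C t₀ X₀) t X

/-- The inverse of `assemble`, which moves an element of `C(t, X)` to the two corners. -/
def disassemble (t : T.Obj) (X : U.Obj) :
    ((dgModK.{u, w} K).Hom (C.obj (t, X)) ((coprod (commaOf C t₀ X₀)).obj (t, X))).X 0 :=
  mkHom fun p q h =>
    coprodInl (commaOf C t₀ X₀) t X ∘ₗ projT C X₀ t ∘ₗ
        app (C.map (M.entryT X X₀ (T.id t))) p q h +
      coprodInr (commaOf C t₀ X₀) t X ∘ₗ projU C t₀ X ∘ₗ
        app (C.map (M.entryU t t₀ (U.id X))) p q h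

variable {C t₀ X₀} {t : T.Obj} {X : U.Obj}

theorem app_assemble {p q : ℤ} (h : p + 0 = q)
    (z : ((coprod (commaOf C t₀ X₀)).obj (t, X)).X p) :
    app (assemble C t₀ X₀ t X) p q h z =
      app (C.map (M.entryT X₀ X (T.id t))) p q h
          (inclT C X₀ t (coprodFst (commaOf C t₀ X₀) t X z)) +
        app (C.map (M.entryU t₀ t (U.id X))) p q h
          (inclU C t₀ X (coprodSnd (commaOf C t₀ X₀) t X z)) := rfl

theorem inclT_fst_disassemble {p : ℤ} (h : p + 0 = p) (z : (C.obj (t, X)).X p) :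
    inclT C X₀ t (coprodFst (commaOf C t₀ X₀) t X (app (disassemble C t₀ X₀ t X) p p h z)) =
      app (C.map (M.entryT X X₀ (T.id t))) p p h z := by
  have e : coprodFst (commaOf C t₀ X₀) t X (app (disassemble C t₀ X₀ t X) p p h z) =
      projT C X₀ t (app (C.map (M.entryT X X₀ (T.id t))) p p h z) := add_zero _
  rw [e, inclT_projT h, app_map_comp C (zero_add 0) _ _ h h h, entryT_comp_entryT, T.id_comp]

theorem inclU_snd_disassemble {p : ℤ} (h : p + 0 = p) (z : (C.obj (t, X)).X p) :
    inclU C t₀ X (coprodSnd (commaOf C t₀ X₀) t X (app (disassemble C t₀ X₀ t X) p p h z)) =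
      app (C.map (M.entryU t t₀ (U.id X))) p p h z := by
  have e : coprodSnd (commaOf C t₀ X₀) t X (app (disassemble C t₀ X₀ t X) p p h z) =
      projU C t₀ X (app (C.map (M.entryU t t₀ (U.id X))) p p h z) := zero_add _
  rw [e, inclU_projU h, app_map_comp C (zero_add 0) _ _ h h h, entryU_comp_entryU, U.id_comp]

theorem assemble_disassemble {p : ℤ} (h : p + 0 = p) (z : (C.obj (t, X)).X p) :
    app (assemble C t₀ X₀ t X) p p h (app (disassemble C t₀ X₀ t X) p p h z) = z := by
  rw [app_assemble, inclT_fst_disassemble, inclU_snd_disassemble,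
    app_map_comp C (zero_add 0) _ _ h h h, app_map_comp C (zero_add 0) _ _ h h h,
    entryT_comp_entryT, entryU_comp_entryU, T.id_comp, U.id_comp, ← app_add, ← map_add,
    ← triMat_id_eq, C.map_id, app_id]

theorem disassemble_assemble {p : ℤ} (h : p + 0 = p)
    (z : ((coprod (commaOf C t₀ X₀)).obj (t, X)).X p) :
    app (disassemble C t₀ X₀ t X) p p h (app (assemble C t₀ X₀ t X) p p h z) = z := by
  refine coprod_ext (inclT_injective ?_) (inclU_injective ?_)
  · rw [inclT_fst_disassemble, app_assemble, map_add, app_map_comp C (zero_add 0) _ _ h h h,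
      app_map_comp C (zero_add 0) _ _ h h h, entryT_comp_entryT, entryT_comp_entryU, T.id_comp,
      map_zero, app_zero, add_zero, app_entryT_id_inclT]
  · rw [inclU_snd_disassemble, app_assemble, map_add, app_map_comp C (zero_add 0) _ _ h h h,
      app_map_comp C (zero_add 0) _ _ h h h, entryU_comp_entryT, entryU_comp_entryU, U.id_comp,
      map_zero, app_zero, zero_add, app_entryU_id_inclU]

/-- The action of `[[f, 0], [m, u]]` on the image of `A(s)` in `C(s, X)`. -/
theorem app_map_entryT_inclT {s : T.Obj} {Y : U.Obj} {n p q : ℤ}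
    (g : (M.triMat.Hom (s, X) (t, Y)).X n) (f : (T.Hom s t).X n) (m : (M.obj (Y, s)).X n)
    (hf : g.1 = f) (hm : g.2.1 = m) (h₀ : p + 0 = p) (h₁ : q + 0 = q) (h : p + n = q)
    (x : ((cornerT C X₀).obj s).X p) :
    app (C.map g) p q h (app (C.map (M.entryT X₀ X (T.id s))) p p h₀ (inclT C X₀ s x)) =
      app (C.map (M.entryT X₀ Y (T.id t))) q q h₁
          (inclT C X₀ t (app ((cornerT C X₀).map f) p q h x)) +
        app (C.map (M.entryU t₀ t (U.id Y))) q q h₁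
          (inclU C t₀ Y (dot (commaOf C t₀ X₀) ((add_comm n p).trans h) m x)) := by
  rw [inclT_map, inclU_dot_commaOf C t₀ X₀ ((add_comm n p).trans h) h m x,
    app_map_comp C (add_zero n) _ _ h₀ h h, app_map_comp C (zero_add n) _ _ h h₁ h,
    app_map_comp C (zero_add n) _ _ h h₁ h, entryT_comp_entryT, entryU_comp_entryM, comp_entryT,
    hf, hm, T.comp_id, T.id_comp, ract_id, lact_id, map_add, app_add]

/-- The action of `[[t, 0], [m, f]]` on the image of `B(X)` in `C(s, X)`. -/
theorem app_map_entryU_inclU {s : T.Obj} {Y : U.Obj} {n p q : ℤ}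
    (g : (M.triMat.Hom (s, X) (t, Y)).X n) (f : (U.Hom X Y).X n) (hf : g.2.2 = f)
    (h₀ : p + 0 = p) (h₁ : q + 0 = q) (h : p + n = q) (y : ((cornerU C t₀).obj X).X p) :
    app (C.map g) p q h (app (C.map (M.entryU t₀ s (U.id X))) p p h₀ (inclU C t₀ X y)) =
      app (C.map (M.entryU t₀ t (U.id Y))) q q h₁
        (inclU C t₀ Y (app ((cornerU C t₀).map f) p q h y)) := by
  rw [inclU_map, app_map_comp C (add_zero n) _ _ h₀ h h, app_map_comp C (zero_add n) _ _ h h₁ h,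
    entryU_comp_entryU, comp_entryU, hf, U.comp_id, U.id_comp]

theorem map_assemble {s : T.Obj} {Y : U.Obj} {n p q : ℤ}
    (g : (M.triMat.Hom (s, X) (t, Y)).X n) (h₀ : p + 0 = p) (h₁ : q + 0 = q) (h : p + n = q)
    (z : ((coprod (commaOf C t₀ X₀)).obj (s, X)).X p) :
    app (C.map g) p q h (app (assemble C t₀ X₀ s X) p p h₀ z) =
      app (assemble C t₀ X₀ t Y) q q h₁
        (app ((coprod (commaOf C t₀ X₀)).map g) p q h z) := by
  have e₁ := app_map_entryT_inclT (t₀ := t₀) g g.1 g.2.1 rfl rfl h₀ h₁ h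
    (coprodFst (commaOf C t₀ X₀) s X z)
  have e₂ := app_map_entryU_inclU g g.2.2 rfl h₀ h₁ h (coprodSnd (commaOf C t₀ X₀) s X z)
  rw [app_assemble, app_assemble, coprodFst_map, coprodSnd_map, map_add, map_add, map_add,
    ← add_assoc]
  exact congrArg₂ (· + ·) e₁ e₂

theorem d_assemble : (dgModK K).d 0 1 (assemble C t₀ X₀ t X) = 0 := by
  have hT : (dgModK K).d 0 1 (C.map (M.entryT X₀ X (T.id t))) = 0 := by
    have h : T.d 0 1 (T.id t) = 0 := T.d_id t
    rw [← C.map_d (zero_add 1), entryT_d, h, map_zero, map_zero]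
  have hU : (dgModK K).d 0 1 (C.map (M.entryU t₀ t (U.id X))) = 0 := by
    have h : U.d 0 1 (U.id X) = 0 := U.d_id X
    rw [← C.map_d (zero_add 1), entryU_d, h, map_zero, map_zero]
  refine app_ext fun p q h z => ?_
  rw [app_d (zero_add 1) _ p q p q h (add_zero p) h (add_zero q), Int.negOnePow_zero, one_smul,
    app_assemble, app_assemble, map_add, d_app_of_closed hT (add_zero p) (add_zero q),
    d_app_of_closed hU (add_zero p) (add_zero q)]
  exact sub_self _

theorem frakF_essSurj [Nonempty T.Obj] [Nonempty U.Obj] (M : DgBimod U T) :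
    M.frakF.EssSurj := by
  intro C
  obtain ⟨t₀⟩ := ‹Nonempty T.Obj›
  obtain ⟨X₀⟩ := ‹Nonempty U.Obj›
  refine ⟨commaOf C t₀ X₀, ?_⟩
  refine dgFun_dgIso_of_components (F := coprod (commaOf C t₀ X₀)) (G := C)
    (fun R => assemble C t₀ X₀ R.1 R.2) (fun R => disassemble C t₀ X₀ R.1 R.2) ?_
    (fun R => d_assemble) ?_ ?_
  · intro R S n g
    refine app_ext fun p q h z => ?_
    refine (app_comp (add_zero n) (C.map g) (assemble C t₀ X₀ R.1 R.2) p p q (add_zero p) h h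
      z).trans (Eq.trans ?_ (app_comp (zero_add n) (assemble C t₀ X₀ S.1 S.2)
        ((coprod (commaOf C t₀ X₀)).map g) p q q h (add_zero q) h z).symm)
    exact map_assemble g (add_zero p) (add_zero q) h z
  · intro R
    refine app_ext fun p q h z => ?_
    obtain rfl : p = q := by omega
    refine (app_comp (zero_add 0) _ _ p p p h h h z).trans (Eq.trans ?_ (app_id p z h).symm)
    exact disassemble_assemble h z
  · intro R
    refine app_ext fun p q h z => ?_
    obtain rfl : p = q := by omega
    refine (app_comp (zero_add 0) _ _ p p p h h h z).trans (Eq.trans ?_ (app_id p z h).symm)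
    exact assemble_disassemble h z

end essSurj
end DgBimod
end Dg

theorem mainTheorem1 {K : Type u} [CommRing K] (T U : Dg.DgCategory.{u, w, w} K)
    [Nonempty T.Obj] [Nonempty U.Obj] (M : Dg.DgBimod U T) :
    M.frakF.IsDgEquivalence ∧ M.frakF.FullyFaithful ∧ M.frakF.EssSurj :=
  have hF := Dg.DgBimod.frakF_fullyFaithful M
  have hS := Dg.DgBimod.frakF_essSurj M
  ⟨hF.isDgEquivalence hS, hF, hS⟩
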